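/- **Proposition 4.8 (cocycle dichotomies).** Fix a complex Hilbert space $\mathsf{k}$ and let $\mathcal{F}_I$ denote the symmetric Fock space over $L^2(I;\mathsf{k})$ for an interval $I\subset\mathbb{R}_+=[0,\infty[$, with $\mathcal{F}:=\mathcal{F}_{\mathbb{R}_+}=\mathcal{F}_{[0,t[}\otimes\mathcal{F}_{[t,\infty[}$. For a norm-closed subspace (operator space) $V$ of $B(\mathfrak{h};\mathfrak{h}')$, where $\mathfrak{h},\mathfrak{h}'$ are Hilbert spaces, let $$V\otimes_M B(\mathsf{h}):=\{T\in B(\mathfrak{h}\otimes\mathsf{h};\mathfrak{h}'\otimes\mathsf{h}): E^dTE_e\in V \text{ for all } d,e\in\mathsf{h}\},$$ where $E_e:u\mapsto u\otimes e$ and $E^d:=(E_d)^*$; for a completely bounded map $\phi:V\to W$ between operator spaces let $\phi\otimes_M\mathrm{id}_{B(\mathsf{h})}:V\otimes_M B(\mathsf{h})\to W\otimes_M B(\mathsf{h})$ be the unique map with $E^d(\phi\otimes_M\mathrm{id}_{B(\mathsf{h})})(T)E_e=\phi(E^dTE_e)$ for all $d,e\in\mathsf{h}$. Let $\sigma_r$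 be the ampliated CCR flow, which maps operators $\mathfrak{h}\otimes\mathcal{F}\to\mathfrak{h}'\otimes\mathcal{F}$ to such operators and is induced by the right shift $L^2(\mathbb{R}_+;\mathsf{k})\to L^2([r,\infty[;\mathsf{k})$ followed by ampliation with $I_{\mathcal{F}_{[0,r[}}$. A *QS cocycle* on $V$ is a family $(k_t)_{t\ge0}$ of completely bounded linear maps $k_t:V\to V\otimes_M B(\mathcal{F})$ which is adapted, $k_t(V)\subset V\otimes_M B(\mathcal{F}_{[0,t[})\otimes I_{[t,\infty[}$, and satisfies $$k_0(a)=a\otimes I_{\mathcal{F}},\qquad k_{r+t}=\widehat{k}_r\circ\sigma_r\circ k_t\quad(r,t\ge0),$$ where $\widehat{k}_r:=k_r\otimes_M\mathrm{id}_{B(\mathcal{F}_{[r,\infty[})}$. A *left* (respectively *right*) *bounded operator QS cocycle* on a Hilbert space $\mathfrak{H}$ is a family $(X_t)_{t\ge0}$ in $B(\mathfrak{H}\otimes\mathcal{F})$ which is adapted, $X_t\in B(\mathfrak{H}\otimes\mathcal{F}_{[0,t[})\otimes I_{[t,\infty[}$, and satisfies $X_0=I$ and $X_{r+t}=X_r\sigma_r(X_t)$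 (respectively $X_{r+t}=\sigma_r(X_t)X_r$) for all $r,t\ge0$. Let $k$ be a QS cocycle on an operator space $V$, let $j$ be a QS cocycle on an operator system $W$ (a norm-closed, adjoint-closed subspace of $B(\mathfrak{L})$ containing $I$, for some Hilbert space $\mathfrak{L}$), and let $X$ be a left or right bounded operator QS cocycle on a Hilbert space $\mathfrak{H}$. Then each of the following sets is either empty or all of $]0,\infty[$: (a) $\{t>0: k_t \text{ is injective}\}$; (b) $\{t>0: X_t \text{ is injective}\}$; (c) $\{t>0: k_t \text{ is completely isometric}\}$, assuming that every $k_t$ is completely contractive; (d) $\{t>0: j_t \text{ is unital}\}$, assuming that every $j_t$ is completely positive and contractive; (e) (i) $\{t>0: X_t \text{ is isometric}\}$ and (ii) $\{t>0: X_t \text{ is coisometric}\}$, assuming that every $X_t$ is a contraction. -/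

import Mathlib

open MeasureTheory
open scoped TensorProduct NNReal ENNReal ComplexInnerProductSpace

noncomputable section

namespace QS

universe u v w u' v' w'

set_option linter.unusedSectionVars false

/-! ### Unitaries determined by total families -/

section Total

variable {ι : Type*} {A B : Type*}
  [NormedAddCommGroup A] [InnerProductSpace ℂ A] [CompleteSpace A]
  [NormedAddCommGroup B] [InnerProductSpace ℂ B] [CompleteSpace B]

/-- A family of vectors is total if its linear span is dense. -/
def IsTotal (a : ι → A) : Prop := Dense (Submodule.span ℂ (Set.range a) : Set A)

lemma IsTotal.denseRange {a : ι → A} (ha : IsTotal a) :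
    DenseRange (Finsupp.linearCombination ℂ a) := by
  have h := Finsupp.range_linearCombination ℂ (v := a)
  unfold IsTotal at ha
  rw [← h] at ha
  simpa [DenseRange] using! ha

lemma inner_linearCombination (a : ι → A) (x y : ι →₀ ℂ) :
    ⟪Finsupp.linearCombination ℂ a x, Finsupp.linearCombination ℂ a y⟫ =
      x.sum fun i c => y.sum fun j d => starRingEnd ℂ c * (d * ⟪a i, a j⟫) := by
  simp only [Finsupp.linearCombination_apply, Finsupp.sum, sum_inner, inner_sum,
    inner_smul_left, inner_smul_right, Finset.mul_sum]
  rw [Finset.sum_comm]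
  exact Finset.sum_congr rfl fun i _ => Finset.sum_congr rfl fun j _ => by ring

/-- The unique unitary carrying one total family onto another one with the same Gram matrix. -/
def unitaryOfTotal (a : ι → A) (b : ι → B) (ha : IsTotal a) (hb : IsTotal b)
    (h : ∀ i j, ⟪b i, b j⟫ = ⟪a i, a j⟫) : A ≃ₗᵢ[ℂ] B :=
  (LinearEquiv.refl ℂ (ι →₀ ℂ)).extendOfIsometry
    (Finsupp.linearCombination ℂ a) (Finsupp.linearCombination ℂ b) ha.denseRange hb.denseRange
    (fun x => by
      rw [LinearEquiv.refl_apply, @norm_eq_sqrt_re_inner ℂ, @norm_eq_sqrt_re_inner ℂ,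
        inner_linearCombination, inner_linearCombination]
      simp only [h])

lemma unitaryOfTotal_apply (a : ι → A) (b : ι → B) (ha : IsTotal a) (hb : IsTotal b)
    (h : ∀ i j, ⟪b i, b j⟫ = ⟪a i, a j⟫) (i : ι) :
    unitaryOfTotal a b ha hb h (a i) = b i := by
  have := LinearEquiv.extend_eq (LinearEquiv.refl ℂ (ι →₀ ℂ))
    (Finsupp.linearCombination ℂ a) (Finsupp.linearCombination ℂ b) ha.denseRange
    ⟨1, fun x => by
      rw [LinearEquiv.refl_apply, one_mul, @norm_eq_sqrt_re_inner ℂ, @norm_eq_sqrt_re_inner ℂ,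
        inner_linearCombination, inner_linearCombination]
      simp only [h]; rfl⟩ hb.denseRange
    ⟨1, fun x => by
      rw [LinearEquiv.refl_symm, LinearEquiv.refl_apply, one_mul, @norm_eq_sqrt_re_inner ℂ,
        @norm_eq_sqrt_re_inner ℂ,
        inner_linearCombination, inner_linearCombination]
      simp only [h]; rfl⟩ (Finsupp.single i 1)
  simpa [unitaryOfTotal, LinearEquiv.extendOfIsometry] using! this

end Total

/-! ### The Hilbert space tensor product -/

section Tensor

variable (H : Type u) (K : Type v)
  [NormedAddCommGroup H] [InnerProductSpace ℂ H]
  [NormedAddCommGroup K] [InnerProductSpace ℂ K]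

/-- The Hilbert space tensor product: the completion of the algebraic tensor product with respect
to the inner product `⟪u ⊗ v, u' ⊗ v'⟫ = ⟪u, u'⟫ ⟪v, v'⟫`. -/
def HTensor : Type (max u v) := UniformSpace.Completion (H ⊗[ℂ] K)

instance : NormedAddCommGroup (HTensor H K) :=
  inferInstanceAs (NormedAddCommGroup (UniformSpace.Completion (H ⊗[ℂ] K)))

instance : InnerProductSpace ℂ (HTensor H K) :=
  inferInstanceAs (InnerProductSpace ℂ (UniformSpace.Completion (H ⊗[ℂ] K)))

instance : CompleteSpace (HTensor H K) :=
  inferInstanceAs (CompleteSpace (UniformSpace.Completion (H ⊗[ℂ] K)))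

end Tensor

infixl:70 " ⊗ₕ " => HTensor

section Tensor

variable {H : Type u} {K : Type v} {H' : Type u'} {K' : Type v'} {M : Type w}
  [NormedAddCommGroup H] [InnerProductSpace ℂ H]
  [NormedAddCommGroup K] [InnerProductSpace ℂ K]
  [NormedAddCommGroup H'] [InnerProductSpace ℂ H']
  [NormedAddCommGroup K'] [InnerProductSpace ℂ K']
  [NormedAddCommGroup M] [InnerProductSpace ℂ M]

/-- The embedding of the algebraic tensor product. -/
def tincl : H ⊗[ℂ] K →ₗᵢ[ℂ] H ⊗ₕ K := UniformSpace.Completion.toComplₗᵢ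

lemma denseRange_tincl : DenseRange (tincl : H ⊗[ℂ] K →ₗᵢ[ℂ] H ⊗ₕ K).toLinearMap :=
  UniformSpace.Completion.denseRange_coe

/-- Elementary tensors. -/
def tm (u : H) (v : K) : H ⊗ₕ K := tincl (u ⊗ₜ[ℂ] v)

lemma inner_tm (u u' : H) (v v' : K) : ⟪tm u v, tm u' v'⟫ = ⟪u, u'⟫ * ⟪v, v'⟫ := by
  rw [tm, tm, LinearIsometry.inner_map_map, TensorProduct.inner_tmul]

lemma norm_tm (u : H) (v : K) : ‖tm u v‖ = ‖u‖ * ‖v‖ := by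
  rw [tm, LinearIsometry.norm_map, TensorProduct.norm_tmul]

/-- `tm` as a bounded bilinear map. -/
def tmL : H →L[ℂ] K →L[ℂ] H ⊗ₕ K :=
  LinearMap.mkContinuous₂ ((TensorProduct.mk ℂ H K).compr₂ tincl.toLinearMap) 1
    (fun u v => by
      rw [one_mul]; exact (norm_tm u v).le)

@[simp] lemma tmL_apply (u : H) (v : K) : tmL u v = tm u v := rfl

/-- Tensor products of total families are total. -/
lemma isTotal_tm {ι κ : Type*} {a : ι → H} {b : κ → K} (ha : IsTotal a) (hb : IsTotal b) :
    IsTotal (fun p : ι × κ => tm (a p.1) (b p.2)) := by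
  set S : Submodule ℂ (H ⊗ₕ K) :=
    (Submodule.span ℂ (Set.range fun p : ι × κ => tm (a p.1) (b p.2))).topologicalClosure
  have hS : IsClosed (S : Set (H ⊗ₕ K)) := Submodule.isClosed_topologicalClosure _
  have h1 : ∀ i v, tm (a i) v ∈ S := by
    intro i
    refine hb.induction (P := fun v => tm (a i) v ∈ S) ?_
      (hS.preimage (tmL (a i)).continuous)
    intro v hv
    have : Submodule.span ℂ (Set.range b) ≤ S.comap (tmL (a i)).toLinearMap := by
      rw [Submodule.span_le]
      rintro _ ⟨j, rfl⟩
      exact Submodule.le_topologicalClosure _ (Submodule.subset_span ⟨(i, j), rfl⟩)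
    exact this hv
  have h2 : ∀ u v, tm u v ∈ S := by
    intro u v
    refine ha.induction (P := fun u => tm u v ∈ S) ?_
      (hS.preimage (tmL.flip v).continuous) u
    intro v' hv'
    have : Submodule.span ℂ (Set.range a) ≤ S.comap (tmL.flip v).toLinearMap := by
      rw [Submodule.span_le]
      rintro _ ⟨j, rfl⟩
      exact h1 j v
    exact this hv'
  have h3 : ∀ x : H ⊗[ℂ] K, tincl x ∈ S := by
    intro x
    induction x using TensorProduct.induction_on with
    | zero => simp
    | tmul u v => exact h2 u v
    | add x y hx hy => rw [map_add]; exact S.add_mem hx hy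
  have h4 : ∀ x, x ∈ S := fun x => denseRange_tincl.induction_on x hS h3
  intro x
  exact h4 x

lemma isTotal_id : IsTotal (fun u : H => u) := by
  unfold IsTotal
  simp

/-- The tensor product `A ⊗ B` of bounded operators. -/
def tmap (A : H →L[ℂ] H') (B : K →L[ℂ] K') : H ⊗ₕ K →L[ℂ] H' ⊗ₕ K' :=
  (tincl.toLinearMap ∘ₗ (TensorProduct.mapL A B).toLinearMap).extendOfNorm tincl.toLinearMap

lemma tmap_tincl (A : H →L[ℂ] H') (B : K →L[ℂ] K') (x : H ⊗[ℂ] K) :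
    tmap A B (tincl x) = tincl (TensorProduct.mapL A B x) := by
  refine LinearMap.extendOfNorm_eq denseRange_tincl ⟨‖TensorProduct.mapL A B‖, fun x => ?_⟩ x
  simpa using (TensorProduct.mapL A B).le_opNorm x

lemma tmap_tm (A : H →L[ℂ] H') (B : K →L[ℂ] K') (u : H) (v : K) :
    tmap A B (tm u v) = tm (A u) (B v) := by
  rw [tm, tmap_tincl]; rfl

lemma isTotal_tm_id : IsTotal (fun p : H × K => tm p.1 p.2) :=
  isTotal_tm (a := fun u : H => u) (b := fun v : K => v) isTotal_id isTotal_id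

/-- The image of a total family under a surjective bounded operator is total. -/
lemma IsTotal.map {ι : Type*} {a : ι → H} (ha : IsTotal a) (U : H →L[ℂ] H')
    (hU : Function.Surjective U) : IsTotal (fun i => U (a i)) := by
  have h1 : Set.range (fun i => U (a i)) = U '' Set.range a := by
    rw [← Set.range_comp]; rfl
  have h2 : (Submodule.span ℂ (Set.range fun i => U (a i)) : Set H') =
      U '' (Submodule.span ℂ (Set.range a) : Set H) := by
    have := Submodule.map_span U.toLinearMap (Set.range a)
    rw [h1]
    exact (congrArg (fun S : Submodule ℂ H' => (S : Set H')) this).symm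
  unfold IsTotal at ha ⊢
  rw [h2]
  exact hU.denseRange.dense_image U.continuous ha

/-- The tensor product of two unitaries. -/
def tcongr (U : H ≃ₗᵢ[ℂ] H') (V : K ≃ₗᵢ[ℂ] K') : H ⊗ₕ K ≃ₗᵢ[ℂ] H' ⊗ₕ K' :=
  unitaryOfTotal (fun p : H × K => tm p.1 p.2) (fun p : H × K => tm (U p.1) (V p.2))
    isTotal_tm_id
    (isTotal_tm (a := fun u : H => U u) (b := fun v : K => V v)
      (isTotal_id.map U.toContinuousLinearEquiv.toContinuousLinearMap U.surjective)
      (isTotal_id.map V.toContinuousLinearEquiv.toContinuousLinearMap V.surjective))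
    (fun p q => by simp only [inner_tm, LinearIsometryEquiv.inner_map_map])

lemma tcongr_tm (U : H ≃ₗᵢ[ℂ] H') (V : K ≃ₗᵢ[ℂ] K') (u : H) (v : K) :
    tcongr U V (tm u v) = tm (U u) (V v) :=
  unitaryOfTotal_apply (fun p : H × K => tm p.1 p.2) (fun p : H × K => tm (U p.1) (V p.2))
    _ _ _ (u, v)

variable (H K M) in
/-- The associativity unitary `(u ⊗ v) ⊗ w ↦ u ⊗ (v ⊗ w)`. -/
def tassoc : (H ⊗ₕ K) ⊗ₕ M ≃ₗᵢ[ℂ] H ⊗ₕ (K ⊗ₕ M) :=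
  unitaryOfTotal (fun p : (H × K) × M => tm (tm p.1.1 p.1.2) p.2)
    (fun p : (H × K) × M => tm p.1.1 (tm p.1.2 p.2))
    (isTotal_tm (a := fun q : H × K => tm q.1 q.2) (b := fun w : M => w)
      isTotal_tm_id isTotal_id)
    (by
      have h := isTotal_tm (a := fun u : H => u) (b := fun q : K × M => tm q.1 q.2)
        isTotal_id isTotal_tm_id
      unfold IsTotal at h ⊢
      rw [← (Equiv.prodAssoc H K M).surjective.range_comp] at h
      exact h)
    (fun p q => by simp only [inner_tm, mul_assoc])

lemma tassoc_tm (u : H) (v : K) (w : M) :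
    tassoc H K M (tm (tm u v) w) = tm u (tm v w) :=
  unitaryOfTotal_apply (fun p : (H × K) × M => tm (tm p.1.1 p.1.2) p.2)
    (fun p : (H × K) × M => tm p.1.1 (tm p.1.2 p.2)) _ _ _ ((u, v), w)

end Tensor

/-! ### Symmetric Fock space -/

/-- A bundled complex Hilbert space. -/
structure HSpace : Type (u + 1) where
  carrier : Type u
  [grp : NormedAddCommGroup carrier]
  [ips : InnerProductSpace ℂ carrier]
  [cpl : CompleteSpace carrier]

attribute [instance] HSpace.grp HSpace.ips HSpace.cpl

section Fock

variable (h : Type u) [NormedAddCommGroup h] [InnerProductSpace ℂ h]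

/-- The Hilbert space tensor powers of `h`, with the one-dimensional space as the zeroth one. -/
def tpow : ℕ → HSpace.{u}
  | 0 => ⟨EuclideanSpace ℂ PUnit.{u + 1}⟩
  | n + 1 => ⟨(tpow n).carrier ⊗ₕ h⟩

variable {h}

/-- The vector `f ⊗ ⋯ ⊗ f` of the `n`-th tensor power. -/
def tpowVec (f : h) : (n : ℕ) → (tpow h n).carrier
  | 0 => EuclideanSpace.single PUnit.unit (1 : ℂ)
  | n + 1 => (tm (tpowVec f n) f : (tpow h n).carrier ⊗ₕ h)

lemma inner_tpowVec (f g : h) (n : ℕ) : ⟪tpowVec f n, tpowVec g n⟫ = ⟪f, g⟫ ^ n := by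
  induction n with
  | zero =>
    change ⟪(EuclideanSpace.single PUnit.unit (1 : ℂ) : EuclideanSpace ℂ PUnit.{u + 1}),
      EuclideanSpace.single PUnit.unit (1 : ℂ)⟫ = _
    simp
  | succ n ih =>
    change ⟪(tm (tpowVec f n) f : (tpow h n).carrier ⊗ₕ h), tm (tpowVec g n) g⟫ = _
    rw [inner_tm, ih, pow_succ]

lemma tpowVec_smul (c : ℂ) (f : h) (n : ℕ) : tpowVec (c • f) n = c ^ n • tpowVec f n := by
  induction n with
  | zero => simp only [tpowVec, pow_zero]; exact (one_smul ℂ _).symm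
  | succ n ih =>
    change (tm (tpowVec (c • f) n) (c • f) : (tpow h n).carrier ⊗ₕ h) =
      c ^ (n + 1) • tm (tpowVec f n) f
    rw [ih, ← tmL_apply, ← tmL_apply, map_smul, map_smul, smul_apply,
      smul_smul, pow_succ, mul_comm]

variable (h) in
/-- The symmetric tensors of degree `n`: the closed linear span of the vectors `f ⊗ ⋯ ⊗ f`. -/
def symPow (n : ℕ) : Submodule ℂ (tpow h n).carrier :=
  (Submodule.span ℂ (Set.range fun f : h => tpowVec f n)).topologicalClosure

instance (n : ℕ) : CompleteSpace (symPow h n) :=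
  (Submodule.isClosed_topologicalClosure _).completeSpace_coe

/-- `f ⊗ ⋯ ⊗ f` as a symmetric tensor. -/
def symVec (f : h) (n : ℕ) : symPow h n :=
  ⟨tpowVec f n, Submodule.le_topologicalClosure _ (Submodule.subset_span ⟨f, rfl⟩)⟩

lemma inner_symVec (f g : h) (n : ℕ) : ⟪symVec f n, symVec g n⟫ = ⟪f, g⟫ ^ n :=
  inner_tpowVec f g n

lemma norm_symVec (f : h) (n : ℕ) : ‖symVec f n‖ = ‖f‖ ^ n := by
  have h1 := inner_symVec f f n
  rw [inner_self_eq_norm_sq_to_K, inner_self_eq_norm_sq_to_K] at h1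
  have h2 : ‖symVec f n‖ ^ 2 = (‖f‖ ^ n) ^ 2 := by
    rw [← pow_mul, mul_comm, pow_mul]
    exact_mod_cast h1
  exact (pow_left_inj₀ (norm_nonneg _) (by positivity) two_ne_zero).1 h2

variable (h) in
/-- The symmetric Fock space over `h`: the Hilbert space direct sum of the symmetric tensor
powers of `h`. -/
def Fock : Type u := lp (fun n => symPow h n) 2

instance : NormedAddCommGroup (Fock h) :=
  inferInstanceAs (NormedAddCommGroup (lp (fun n => symPow h n) 2))

instance : InnerProductSpace ℂ (Fock h) :=
  inferInstanceAs (InnerProductSpace ℂ (lp (fun n => symPow h n) 2))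

instance : CompleteSpace (Fock h) :=
  inferInstanceAs (CompleteSpace (lp (fun n => symPow h n) 2))

lemma norm_expComp_sq (f : h) (n : ℕ) :
    ‖(((Real.sqrt (n.factorial : ℝ))⁻¹ : ℝ) : ℂ) • symVec f n‖ ^ 2 =
      (‖f‖ ^ 2) ^ n / n.factorial := by
  rw [norm_smul, norm_symVec, mul_pow, Complex.norm_real, norm_inv, inv_pow, Real.norm_eq_abs,
    sq_abs, Real.sq_sqrt (by positivity)]
  ring

/-- The exponential vector `((n!)^{-1/2} f ⊗ ⋯ ⊗ f)_{n ≥ 0}`. -/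
def expVec (f : h) : Fock h :=
  (⟨fun n => (((Real.sqrt (n.factorial : ℝ))⁻¹ : ℝ) : ℂ) • symVec f n, by
    refine memℓp_gen ?_
    have := Real.summable_pow_div_factorial (‖f‖ ^ 2)
    refine this.congr fun n => ?_
    rw [← norm_expComp_sq]
    norm_cast⟩ : lp (fun n => symPow h n) 2)

lemma inner_expVec (f g : h) : ⟪expVec f, expVec g⟫ = Complex.exp ⟪f, g⟫ := by
  have h1 := lp.hasSum_inner (𝕜 := ℂ) (G := fun n => symPow h n) (expVec f) (expVec g)
  have h2 : HasSum (fun n : ℕ => ⟪f, g⟫ ^ n / (n.factorial : ℂ)) (Complex.exp ⟪f, g⟫) := by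
    rw [Complex.exp_eq_exp_ℂ]
    exact NormedSpace.expSeries_div_hasSum_exp _
  have h3 : (fun n : ℕ => ⟪f, g⟫ ^ n / (n.factorial : ℂ)) =
      fun n => ⟪(((Real.sqrt (n.factorial : ℝ))⁻¹ : ℝ) : ℂ) • symVec f n,
        (((Real.sqrt (n.factorial : ℝ))⁻¹ : ℝ) : ℂ) • symVec g n⟫ := by
    funext n
    rw [inner_smul_left, inner_smul_right, inner_symVec, Complex.conj_ofReal, ← mul_assoc,
      ← Complex.ofReal_mul, ← mul_inv, Real.mul_self_sqrt (by positivity), div_eq_mul_inv,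
      mul_comm]
    push_cast
    rfl
  rw [h3] at h2
  exact h1.unique h2

/-- The exponential vectors are total in Fock space. -/
lemma isTotal_expVec : IsTotal (fun f : h => expVec f) := by
  unfold IsTotal
  rw [Submodule.dense_iff_topologicalClosure_eq_top, Submodule.topologicalClosure_eq_top_iff,
    Submodule.eq_bot_iff]
  intro ξ hξ
  have h0 : ∀ f : h, ⟪expVec f, ξ⟫ = 0 := fun f =>
    (Submodule.mem_orthogonal _ _).1 hξ _ (Submodule.subset_span ⟨f, rfl⟩)
  let η : lp (fun n => symPow h n) 2 := ξ
  have h1 : ∀ (f : h) (n : ℕ), ⟪symVec f n, η n⟫ = 0 := by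
    intro f
    let a : ℕ → ℂ := fun n => (((Real.sqrt (n.factorial : ℝ))⁻¹ : ℝ) : ℂ) * ⟪symVec f n, η n⟫
    have hs : ∀ z : ℂ, HasSum (fun n => z ^ n • a n) 0 := by
      intro z
      let e : lp (fun n => symPow h n) 2 := expVec (starRingEnd ℂ z • f)
      have h2 := lp.hasSum_inner (𝕜 := ℂ) (G := fun n => symPow h n) e η
      have h3 : HasSum (fun n => ⟪e n, η n⟫) (0 : ℂ) := by
        have h3' : ⟪e, η⟫ = 0 := h0 (starRingEnd ℂ z • f)
        rwa [h3'] at h2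
      refine h3.congr_fun fun n => Eq.symm ?_
      change ⟪(((Real.sqrt (n.factorial : ℝ))⁻¹ : ℝ) : ℂ) • symVec (starRingEnd ℂ z • f) n, η n⟫
        = _
      have h4 : symVec (starRingEnd ℂ z • f) n = (starRingEnd ℂ z) ^ n • symVec f n :=
        Subtype.ext (tpowVec_smul _ _ _)
      rw [h4, inner_smul_left, inner_smul_left, Complex.conj_ofReal, map_pow, Complex.conj_conj,
        smul_eq_mul]
      ring
    have hp : HasFPowerSeriesAt (0 : ℂ → ℂ) (FormalMultilinearSeries.ofScalars ℂ a) 0 := by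
      rw [hasFPowerSeriesAt_iff]
      refine Filter.Eventually.of_forall fun z => ?_
      simpa [FormalMultilinearSeries.coeff_ofScalars] using hs z
    intro n
    have h5 : (FormalMultilinearSeries.ofScalars ℂ a).coeff n = 0 := by
      rw [hp.eq_zero]; rfl
    rw [FormalMultilinearSeries.coeff_ofScalars] at h5
    refine (mul_eq_zero.1 h5).resolve_left ?_
    have : (0 : ℝ) < Real.sqrt (n.factorial : ℝ) := Real.sqrt_pos.2 (by positivity)
    exact_mod_cast (inv_pos.2 this).ne'
  have h6 : ∀ n, η n = 0 := by
    intro n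
    have h7 : ((η n : symPow h n) : (tpow h n).carrier) ∈
        (Submodule.span ℂ (Set.range fun f : h => tpowVec f n)).topologicalClosureᗮ := by
      rw [Submodule.orthogonal_closure, Submodule.mem_orthogonal]
      intro u hu
      induction hu using Submodule.span_induction with
      | mem x hx => obtain ⟨f, rfl⟩ := hx; exact h1 f n
      | zero => exact inner_zero_left _
      | add x y _ _ hx hy => rw [inner_add_left, hx, hy, add_zero]
      | smul c x _ hx => rw [inner_smul_left, hx, mul_zero]
    have h8 := (Submodule.mem_orthogonal _ _).1 h7 _ (η n).2
    exact Subtype.ext (inner_self_eq_zero.1 h8)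
  exact lp.ext (funext h6)

end Fock

section FockFunctor

variable {h : Type u} {h' : Type v} [NormedAddCommGroup h] [InnerProductSpace ℂ h]
  [NormedAddCommGroup h'] [InnerProductSpace ℂ h']

/-- Second quantisation of a unitary. -/
def fockMap (U : h ≃ₗᵢ[ℂ] h') : Fock h ≃ₗᵢ[ℂ] Fock h' :=
  unitaryOfTotal (fun f : h => expVec f) (fun f : h => expVec (U f)) isTotal_expVec
    (by
      have h1 := isTotal_expVec (h := h')
      unfold IsTotal at h1 ⊢
      rwa [← U.surjective.range_comp] at h1)
    (fun f g => by rw [inner_expVec, inner_expVec, LinearIsometryEquiv.inner_map_map])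

lemma fockMap_expVec (U : h ≃ₗᵢ[ℂ] h') (f : h) : fockMap U (expVec f) = expVec (U f) :=
  unitaryOfTotal_apply (fun f : h => expVec f) (fun f : h => expVec (U f)) _ _ _ f

end FockFunctor

/-! ### Square-integrable functions on time intervals -/

section Time

variable (κ : Type u) [NormedAddCommGroup κ] [InnerProductSpace ℂ κ]

/-- `L²(J; κ)` with respect to Lebesgue measure on a set `J` of times. -/
abbrev L2 (J : Set ℝ) : Type u := Lp κ 2 (volume.restrict J)

/-- `Fock J`: the symmetric Fock space over `L²(J; κ)`. -/
abbrev FockOn (J : Set ℝ) : Type u := Fock (L2 κ J)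

/-- The set `R` of times is split into the disjoint measurable sets `s` and `t`. -/
structure Split (R s t : Set ℝ) : Prop where
  left : MeasurableSet s
  right : MeasurableSet t
  disj : Disjoint s t
  union : s ∪ t = R

variable {κ} {R s t : Set ℝ}

lemma Split.swap (S : Split R s t) : Split R t s :=
  ⟨S.right, S.left, S.disj.symm, by rw [Set.union_comm, S.union]⟩

lemma Split.sub (S : Split R s t) : s ⊆ R := S.union ▸ Set.subset_union_left

/-- Restriction of a function to a smaller set of times. -/
def restr (hs : s ⊆ R) (f : L2 κ R) : L2 κ s :=
  ((Lp.memLp f).mono_measure (Measure.restrict_mono_set volume hs)).toLp f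

lemma restr_coe (hs : s ⊆ R) (f : L2 κ R) : restr hs f =ᵐ[volume.restrict s] f :=
  MemLp.coeFn_toLp _

lemma Split.inner_eq (S : Split R s t) (f g : L2 κ R) :
    ⟪f, g⟫ = ⟪restr S.sub f, restr S.sub g⟫ + ⟪restr S.swap.sub f, restr S.swap.sub g⟫ := by
  have hi := L2.integrable_inner (𝕜 := ℂ) f g
  have h0 : ∀ {a : Set ℝ} (ha : a ⊆ R),
      ⟪restr ha f, restr ha g⟫ = ∫ x in a, ⟪f x, g x⟫ := by
    intro a ha
    rw [L2.inner_def]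
    refine integral_congr_ae ?_
    filter_upwards [restr_coe ha f, restr_coe ha g] with x h1 h2
    rw [h1, h2]
  rw [h0, h0, L2.inner_def]
  have := setIntegral_union (μ := volume) (f := fun x => (⟪f x, g x⟫ : ℂ)) S.disj S.right
    (IntegrableOn.mono_set (t := R) hi S.sub)
    (IntegrableOn.mono_set (t := R) hi S.swap.sub)
  rw [S.union] at this
  exact this

lemma Split.surj (S : Split R s t) (g₁ : L2 κ s) (g₂ : L2 κ t) :
    ∃ f : L2 κ R, restr S.sub f = g₁ ∧ restr S.swap.sub f = g₂ := by
  have m1 : MemLp (s.indicator g₁ + t.indicator g₂) 2 (volume.restrict R) := by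
    refine MemLp.add ?_ ?_
    · rw [memLp_indicator_iff_restrict S.left, Measure.restrict_restrict_of_subset S.sub]
      exact Lp.memLp g₁
    · rw [memLp_indicator_iff_restrict S.right, Measure.restrict_restrict_of_subset S.swap.sub]
      exact Lp.memLp g₂
  have hf := MemLp.coeFn_toLp m1
  refine ⟨m1.toLp _, Lp.ext ?_, Lp.ext ?_⟩
  · refine (restr_coe _ _).trans ?_
    filter_upwards [ae_mono (Measure.restrict_mono_set volume S.sub) hf,
      ae_restrict_mem S.left] with x h1 h2
    rw [h1, Pi.add_apply, Set.indicator_of_mem h2,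
      Set.indicator_of_notMem (S.disj.notMem_of_mem_left h2), add_zero]
  · refine (restr_coe _ _).trans ?_
    filter_upwards [ae_mono (Measure.restrict_mono_set volume S.swap.sub) hf,
      ae_restrict_mem S.right] with x h1 h2
    rw [h1, Pi.add_apply, Set.indicator_of_mem h2,
      Set.indicator_of_notMem (S.disj.notMem_of_mem_right h2), zero_add]

/-- The exponential property of Fock space: the unitary carrying
`ε(f|ₛ) ⊗ ε(f|ₜ)` to `ε(f)`. -/
def fockSplit (S : Split R s t) : FockOn κ s ⊗ₕ FockOn κ t ≃ₗᵢ[ℂ] FockOn κ R :=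
  unitaryOfTotal
    (fun f : L2 κ R => tm (expVec (restr S.sub f)) (expVec (restr S.swap.sub f)))
    (fun f : L2 κ R => expVec f)
    (by
      have h1 := isTotal_tm (isTotal_expVec (h := L2 κ s)) (isTotal_expVec (h := L2 κ t))
      have h2 : Function.Surjective
          (fun f : L2 κ R => (restr S.sub f, restr S.swap.sub f)) := fun p => by
        obtain ⟨f, hf⟩ := S.surj p.1 p.2
        exact ⟨f, Prod.ext hf.1 hf.2⟩
      unfold IsTotal at h1 ⊢
      rw [← h2.range_comp] at h1
      exact h1)
    isTotal_expVec
    (fun f g => by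
      rw [inner_tm, inner_expVec, inner_expVec, inner_expVec, ← Complex.exp_add, S.inner_eq])

lemma fockSplit_expVec (S : Split R s t) (f : L2 κ R) :
    fockSplit S (tm (expVec (restr S.sub f)) (expVec (restr S.swap.sub f))) = expVec f :=
  unitaryOfTotal_apply
    (fun f : L2 κ R => tm (expVec (restr S.sub f)) (expVec (restr S.swap.sub f)))
    (fun f : L2 κ R => expVec f) _ _ _ f

/-- The time axis `[0, ∞[`. -/
abbrev axis : Set ℝ := Set.Ici 0

/-- The times `[0, r[`. -/
abbrev before (r : ℝ≥0) : Set ℝ := Set.Ico 0 (r : ℝ)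

/-- The times `[r, ∞[`. -/
abbrev after (r : ℝ≥0) : Set ℝ := Set.Ici (r : ℝ)

lemma cut (r : ℝ≥0) : Split axis (before r) (after r) where
  left := measurableSet_Ico
  right := measurableSet_Ici
  disj := by
    rw [Set.disjoint_left]
    exact fun x hx hx' => not_lt_of_ge hx' hx.2
  union := Set.Ico_union_Ici_eq_Ici r.2

lemma measurePreserving_shift (r : ℝ≥0) :
    MeasurePreserving (fun x : ℝ => x - r) (volume.restrict (after r)) (volume.restrict axis) := by
  have h1 := (measurePreserving_sub_right (volume : Measure ℝ) (r : ℝ)).restrict_preimage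
    (s := axis) measurableSet_Ici
  have h2 : (fun x : ℝ => x - r) ⁻¹' axis = after r := by ext x; simp
  rwa [h2] at h1

lemma measurePreserving_unshift (r : ℝ≥0) :
    MeasurePreserving (fun x : ℝ => x + r) (volume.restrict axis) (volume.restrict (after r)) := by
  have h1 := (measurePreserving_add_right (volume : Measure ℝ) (r : ℝ)).restrict_preimage
    (s := after r) measurableSet_Ici
  have h2 : (fun x : ℝ => x + r) ⁻¹' after r = axis := by ext x; simp
  rwa [h2] at h1

variable (κ) in
/-- The right shift `L²([0, ∞[; κ) → L²([r, ∞[; κ)`, `(s_r f)(x) = f(x - r)`, as a unitary. -/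
def shiftL2 (r : ℝ≥0) : L2 κ axis ≃ₗᵢ[ℂ] L2 κ (after r) :=
  LinearIsometryEquiv.ofSurjective
    (Lp.compMeasurePreservingₗᵢ ℂ (fun x : ℝ => x - r) (measurePreserving_shift r))
    (fun g => by
      refine ⟨Lp.compMeasurePreserving _ (measurePreserving_unshift r) g, ?_⟩
      change Lp.compMeasurePreserving (fun x : ℝ => x - r) (measurePreserving_shift r)
        (Lp.compMeasurePreserving _ (measurePreserving_unshift r) g) = g
      rw [← Lp.compMeasurePreserving_comp_apply]
      have : ((fun x : ℝ => x + r) ∘ fun x : ℝ => x - r) = id := by funext x; simp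
      simp [this])

lemma shiftL2_coe (r : ℝ≥0) (f : L2 κ axis) :
    shiftL2 κ r f =ᵐ[volume.restrict (after r)] fun x => f (x - r) :=
  Lp.coeFn_compMeasurePreserving f (measurePreserving_shift r)

variable (κ) in
/-- The unitary `Fock [0, ∞[ → Fock [r, ∞[` induced by the right shift by `r`. -/
def shiftFock (r : ℝ≥0) : FockOn κ axis ≃ₗᵢ[ℂ] FockOn κ (after r) := fockMap (shiftL2 κ r)

end Time

/-! ### Operator spaces, matrix norms, matrix spaces -/

section Operators

variable {H : Type*} {K : Type*} {H' : Type*} {K' : Type*} {h : Type*}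
  [NormedAddCommGroup H] [InnerProductSpace ℂ H]
  [NormedAddCommGroup K] [InnerProductSpace ℂ K] [CompleteSpace K]
  [NormedAddCommGroup H'] [InnerProductSpace ℂ H']
  [NormedAddCommGroup K'] [InnerProductSpace ℂ K'] [CompleteSpace K']
  [NormedAddCommGroup h] [InnerProductSpace ℂ h]

/-- The operator `Hⁿ → Kⁿ` given by an `n × n` matrix of operators `H → K`. -/
def matOp {n : ℕ} (A : Matrix (Fin n) (Fin n) (H →L[ℂ] K)) :
    PiLp 2 (fun _ : Fin n => H) →L[ℂ] PiLp 2 (fun _ : Fin n => K) :=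
  (PiLp.continuousLinearEquiv 2 ℂ (fun _ : Fin n => K)).symm.toContinuousLinearMap ∘L
    ContinuousLinearMap.pi fun i => ∑ j, A i j ∘L PiLp.proj 2 (fun _ : Fin n => H) j

lemma matOp_apply {n : ℕ} (A : Matrix (Fin n) (Fin n) (H →L[ℂ] K))
    (x : PiLp 2 (fun _ : Fin n => H)) (i : Fin n) : matOp A x i = ∑ j, A i j (x j) := by
  simp [matOp]

/-- The operator given by a matrix over a space `V` of operators. -/
abbrev matOn {V : Submodule ℂ (H →L[ℂ] K)} {n : ℕ} (A : Matrix (Fin n) (Fin n) V) :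
    PiLp 2 (fun _ : Fin n => H) →L[ℂ] PiLp 2 (fun _ : Fin n => K) :=
  matOp (A.map fun a => (a : H →L[ℂ] K))

variable {V : Submodule ℂ (H →L[ℂ] K)} {W : Submodule ℂ (H' →L[ℂ] K')}

/-- Complete boundedness. -/
def IsCB (φ : V →ₗ[ℂ] W) : Prop :=
  ∃ C : ℝ, ∀ (n : ℕ) (A : Matrix (Fin n) (Fin n) V), ‖matOn (A.map φ)‖ ≤ C * ‖matOn A‖

/-- Complete contractivity. -/
def IsCC (φ : V →ₗ[ℂ] W) : Prop :=
  ∀ (n : ℕ) (A : Matrix (Fin n) (Fin n) V), ‖matOn (A.map φ)‖ ≤ ‖matOn A‖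

/-- Complete isometry. -/
def IsCI (φ : V →ₗ[ℂ] W) : Prop :=
  ∀ (n : ℕ) (A : Matrix (Fin n) (Fin n) V), ‖matOn (A.map φ)‖ = ‖matOn A‖

/-- Complete positivity. -/
def IsCP {V : Submodule ℂ (H →L[ℂ] H)} {W : Submodule ℂ (H' →L[ℂ] H')} (φ : V →ₗ[ℂ] W) : Prop :=
  ∀ (n : ℕ) (A : Matrix (Fin n) (Fin n) V), (matOn A).IsPositive → (matOn (A.map φ)).IsPositive

/-- The operator `E_e : u ↦ u ⊗ e`. -/
def emb (e : h) : H →L[ℂ] H ⊗ₕ h := tmL.flip e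

/-- The slice `E^d T E_e`, where `E^d` is the adjoint of `E_d`. -/
def slice (d e : h) : (H ⊗ₕ h →L[ℂ] K ⊗ₕ h) →ₗ[ℂ] (H →L[ℂ] K) where
  toFun T := ContinuousLinearMap.adjoint (emb d) ∘L T ∘L emb e
  map_add' S T := by ext; simp
  map_smul' c T := by ext; simp

lemma inner_slice (d e : h) (T : H ⊗ₕ h →L[ℂ] K ⊗ₕ h) (u : H) (v : K) :
    ⟪v, slice d e T u⟫ = ⟪tm v d, T (tm u e)⟫ := by
  change ⟪v, ContinuousLinearMap.adjoint (emb d) (T (emb e u))⟫ = _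
  rw [ContinuousLinearMap.adjoint_inner_right]
  rfl

/-- The (right) `h`-matrix space `V ⊗_M B(h)` over `V`: the operators all of whose slices
lie in `V`. -/
def matrixSpace (V : Submodule ℂ (H →L[ℂ] K)) (h : Type*) [NormedAddCommGroup h]
    [InnerProductSpace ℂ h] : Submodule ℂ (H ⊗ₕ h →L[ℂ] K ⊗ₕ h) where
  carrier := {T | ∀ d e : h, slice d e T ∈ V}
  add_mem' hS hT d e := by rw [map_add]; exact V.add_mem (hS d e) (hT d e)
  zero_mem' d e := by rw [map_zero]; exact V.zero_mem
  smul_mem' c T hT d e := by rw [map_smul]; exact V.smul_mem c (hT d e)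

/-- The slice of an element of a matrix space, as an element of the underlying space. -/
def sliceIn (d e : h) : matrixSpace V h →ₗ[ℂ] V :=
  ((slice d e).domRestrict (matrixSpace V h)).codRestrict V fun T => T.2 d e

/-- `Φ` is a lifting of `φ` to matrix spaces: `E^d Φ(T) E_e = φ(E^d T E_e)`. -/
def IsLifting (φ : V →ₗ[ℂ] W) (Φ : matrixSpace V h →ₗ[ℂ] matrixSpace W h) : Prop :=
  ∀ (T : matrixSpace V h) (d e : h), sliceIn d e (Φ T) = φ (sliceIn d e T)

/-! The existence and uniqueness of liftings of completely bounded maps. -/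

/-- Operators with equal slices are equal. -/
lemma ext_slice {S T : H ⊗ₕ h →L[ℂ] K ⊗ₕ h} (hST : ∀ d e : h, slice d e S = slice d e T) :
    S = T := by
  have h1 : ∀ (u : H) (e : h), S (tm u e) = T (tm u e) := by
    intro u e
    have h2 := (isTotal_tm_id (H := K) (K := h))
    refine h2.eq_of_inner_right (𝕜 := ℂ) fun z hz => ?_
    induction hz using Submodule.span_induction with
    | mem x hx =>
      obtain ⟨p, rfl⟩ := hx
      change ⟪tm p.1 p.2, S (tm u e)⟫ = ⟪tm p.1 p.2, T (tm u e)⟫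
      rw [← inner_slice, ← inner_slice, hST]
    | zero => simp
    | add x y _ _ hx hy => rw [inner_add_left, inner_add_left, hx, hy]
    | smul c x _ hx => rw [inner_smul_left, inner_smul_left, hx]
  have h3 := (isTotal_tm_id (H := H) (K := h))
  refine ContinuousLinearMap.ext_on h3 ?_
  rintro _ ⟨p, rfl⟩
  exact h1 p.1 p.2

/-- The isometry `Hⁿ → H ⊗ h` given by an orthonormal family of `n` vectors of `h`. -/
def rowL {n : ℕ} (f : Fin n → h) : PiLp 2 (fun _ : Fin n => H) →L[ℂ] H ⊗ₕ h :=
  ∑ a, emb (f a) ∘L PiLp.proj 2 (fun _ : Fin n => H) a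

lemma rowL_apply {n : ℕ} (f : Fin n → h) (x : PiLp 2 (fun _ : Fin n => H)) :
    rowL f x = ∑ a, tm (x a) (f a) := by
  simp [rowL, emb]

lemma norm_rowL {n : ℕ} {f : Fin n → h} (hf : Orthonormal ℂ f)
    (x : PiLp 2 (fun _ : Fin n => H)) : ‖rowL f x‖ = ‖x‖ := by
  rw [rowL_apply, @norm_eq_sqrt_re_inner ℂ, @norm_eq_sqrt_re_inner ℂ (PiLp 2 fun _ : Fin n => H),
    PiLp.inner_apply]
  congr 2
  rw [sum_inner]
  refine Finset.sum_congr rfl fun a _ => ?_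
  rw [inner_sum, Finset.sum_eq_single a]
  · rw [inner_tm, inner_self_eq_norm_sq_to_K (f a), hf.1 a]; simp
  · intro b _ hb
    rw [inner_tm, hf.2 hb.symm, mul_zero]
  · simp

lemma inner_matOp_slice {n : ℕ} (f : Fin n → h) (T : H ⊗ₕ h →L[ℂ] K ⊗ₕ h)
    (x : PiLp 2 (fun _ : Fin n => H)) (y : PiLp 2 (fun _ : Fin n => K)) :
    ⟪y, matOp (Matrix.of fun b a => slice (f b) (f a) T) x⟫ = ⟪rowL f y, T (rowL f x)⟫ := by
  rw [PiLp.inner_apply, rowL_apply, rowL_apply, map_sum, sum_inner]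
  refine Finset.sum_congr rfl fun b _ => ?_
  rw [matOp_apply, inner_sum, inner_sum]
  refine Finset.sum_congr rfl fun a _ => ?_
  rw [Matrix.of_apply, inner_slice]

lemma norm_matOp_slice_le {n : ℕ} {f : Fin n → h} (hf : Orthonormal ℂ f)
    (T : H ⊗ₕ h →L[ℂ] K ⊗ₕ h) :
    ‖matOp (Matrix.of fun b a => slice (f b) (f a) T)‖ ≤ ‖T‖ := by
  refine ContinuousLinearMap.opNorm_le_bound _ (norm_nonneg _) fun x => ?_
  set z := matOp (Matrix.of fun b a => slice (f b) (f a) T) x with hz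
  have h1 : ‖z‖ * ‖z‖ ≤ ‖z‖ * (‖T‖ * ‖x‖) := by
    have h2 : ⟪z, z⟫ = ⟪rowL f z, T (rowL f x)⟫ := by
      conv_lhs => rw [hz]
      rw [← hz, ← inner_matOp_slice]
    calc ‖z‖ * ‖z‖ = ‖⟪z, z⟫‖ := by
          rw [inner_self_eq_norm_sq_to_K]; simp [sq]
      _ = ‖⟪rowL f z, T (rowL f x)⟫‖ := by rw [h2]
      _ ≤ ‖rowL f z‖ * ‖T (rowL f x)‖ := norm_inner_le_norm _ _
      _ ≤ ‖z‖ * (‖T‖ * ‖x‖) := by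
          rw [norm_rowL hf]
          have := T.le_opNorm (rowL f x)
          rw [norm_rowL hf] at this
          gcongr
  rcases (norm_nonneg z).eq_or_lt with h0 | h0
  · rw [← h0]; positivity
  · exact le_of_mul_le_mul_left h1 h0

lemma sum_tm {ι : Type*} (F : Finset ι) (g : ι → H) (e : h) :
    ∑ i ∈ F, tm (g i) e = tm (∑ i ∈ F, g i) e :=
  (map_sum (tmL.flip e) g F).symm

lemma linearCombination_eq_rowL {n : ℕ} (f : Fin n → h) (x : H × h →₀ ℂ)
    (hx : ∀ i ∈ x.support, ∑ a, ⟪f a, i.2⟫ • f a = i.2) :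
    Finsupp.linearCombination ℂ (fun p : H × h => tm p.1 p.2) x =
      rowL f (WithLp.toLp 2 fun a => ∑ i ∈ x.support, (x i * ⟪f a, i.2⟫) • i.1) := by
  rw [rowL_apply, Finsupp.linearCombination_apply, Finsupp.sum]
  have h1 : ∀ i ∈ x.support, x i • tm i.1 i.2 =
      ∑ a, tm ((x i * ⟪f a, i.2⟫) • i.1) (f a) := by
    intro i hi
    conv_lhs => rw [← hx i hi]
    simp only [← tmL_apply, map_sum, map_smul, smul_apply, Finset.smul_sum, smul_smul]
  rw [Finset.sum_congr rfl h1, Finset.sum_comm]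
  refine Finset.sum_congr rfl fun a _ => ?_
  exact sum_tm _ _ _

lemma sliceIn_expand {n : ℕ} (T : matrixSpace V h) (f : Fin n → h) {e d : h}
    (he : ∑ a, ⟪f a, e⟫ • f a = e) (hd : ∑ a, ⟪f a, d⟫ • f a = d) :
    sliceIn e d T = ∑ b, ∑ a, (starRingEnd ℂ ⟪f b, e⟫ * ⟪f a, d⟫) • sliceIn (f b) (f a) T := by
  refine Subtype.ext (ContinuousLinearMap.ext fun u => ext_inner_left ℂ fun v => ?_)
  simp only [Submodule.coe_sum, Submodule.coe_smul, sum_apply, smul_apply, inner_sum,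
    inner_smul_right]
  change ⟪v, slice e d (T : H ⊗ₕ h →L[ℂ] K ⊗ₕ h) u⟫ = ∑ b, ∑ a, _ *
    ⟪v, slice (f b) (f a) (T : H ⊗ₕ h →L[ℂ] K ⊗ₕ h) u⟫
  simp only [inner_slice]
  conv_lhs => rw [← he, ← hd]
  simp only [← tmL_apply, map_sum, map_smul, sum_inner, inner_sum, inner_smul_left,
    inner_smul_right, Finset.mul_sum]
  rw [Finset.sum_comm]
  exact Finset.sum_congr rfl fun b _ => Finset.sum_congr rfl fun a _ => by ring

section Existence

variable (φ : V →ₗ[ℂ] W) (T : matrixSpace V h)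

/-- The matrix elements of the lifting. -/
def liftForm (x : H' × h →₀ ℂ) (y : K' × h →₀ ℂ) : ℂ :=
  ∑ i ∈ x.support, ∑ j ∈ y.support,
    starRingEnd ℂ (y j) * (x i * ⟪j.1, (φ (sliceIn j.2 i.2 T) : H' →L[ℂ] K') i.1⟫)

lemma norm_liftForm_le {C : ℝ}
    (hC : ∀ (n : ℕ) (A : Matrix (Fin n) (Fin n) V), ‖matOn (A.map φ)‖ ≤ C * ‖matOn A‖)
    (x : H' × h →₀ ℂ) (y : K' × h →₀ ℂ) :
    ‖liftForm φ T x y‖ ≤ |C| * ‖(T : H ⊗ₕ h →L[ℂ] K ⊗ₕ h)‖ *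
      ‖Finsupp.linearCombination ℂ (fun p : H' × h => tm p.1 p.2) x‖ *
      ‖Finsupp.linearCombination ℂ (fun p : K' × h => tm p.1 p.2) y‖ := by
  classical
  let s : Finset h := x.support.image Prod.snd ∪ y.support.image Prod.snd
  let S : Submodule ℂ h := Submodule.span ℂ (s : Set h)
  let n := Module.finrank ℂ S
  let b : OrthonormalBasis (Fin n) ℂ S := stdOrthonormalBasis ℂ S
  let f : Fin n → h := fun a => (b a : h)
  have hf : Orthonormal ℂ f := b.orthonormal.comp_linearIsometry S.subtypeₗᵢ
  have hexp : ∀ d ∈ s, ∑ a, ⟪f a, d⟫ • f a = d := by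
    intro d hd
    have h1 := b.sum_repr' ⟨d, Submodule.subset_span hd⟩
    have h2 := congrArg (fun z : S => (z : h)) h1
    simpa using! h2
  let u : PiLp 2 (fun _ : Fin n => H') :=
    WithLp.toLp 2 fun a => ∑ i ∈ x.support, (x i * ⟪f a, i.2⟫) • i.1
  let v : PiLp 2 (fun _ : Fin n => K') :=
    WithLp.toLp 2 fun a => ∑ j ∈ y.support, (y j * ⟪f a, j.2⟫) • j.1
  have hu : Finsupp.linearCombination ℂ (fun p : H' × h => tm p.1 p.2) x = rowL f u := by
    exact linearCombination_eq_rowL f x fun i hi =>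
      hexp _ (Finset.mem_union_left _ (Finset.mem_image_of_mem _ hi))
  have hv : Finsupp.linearCombination ℂ (fun p : K' × h => tm p.1 p.2) y = rowL f v := by
    exact linearCombination_eq_rowL f y fun i hi =>
      hexp _ (Finset.mem_union_right _ (Finset.mem_image_of_mem _ hi))
  let A : Matrix (Fin n) (Fin n) V := Matrix.of fun b a => sliceIn (f b) (f a) T
  have hA : liftForm φ T x y = ⟪v, matOn (A.map φ) u⟫ := by
    have h1 : ⟪v, matOn (A.map φ) u⟫ = ∑ b, ∑ a, ∑ j ∈ y.support, ∑ i ∈ x.support,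
        starRingEnd ℂ (y j * ⟪f b, j.2⟫) * ((x i * ⟪f a, i.2⟫) *
          ⟪j.1, (φ (sliceIn (f b) (f a) T) : H' →L[ℂ] K') i.1⟫) := by
      rw [PiLp.inner_apply]
      refine Finset.sum_congr rfl fun b _ => ?_
      rw [matOp_apply, inner_sum]
      refine Finset.sum_congr rfl fun a _ => ?_
      change ⟪∑ j ∈ y.support, (y j * ⟪f b, j.2⟫) • j.1,
        (φ (sliceIn (f b) (f a) T) : H' →L[ℂ] K') (∑ i ∈ x.support, (x i * ⟪f a, i.2⟫) • i.1)⟫ = _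
      rw [sum_inner]
      refine Finset.sum_congr rfl fun j _ => ?_
      rw [map_sum, inner_sum]
      refine Finset.sum_congr rfl fun i _ => ?_
      rw [map_smul, inner_smul_left, inner_smul_right]
    have h2 : liftForm φ T x y = ∑ i ∈ x.support, ∑ j ∈ y.support, ∑ b, ∑ a,
        starRingEnd ℂ (y j * ⟪f b, j.2⟫) * ((x i * ⟪f a, i.2⟫) *
          ⟪j.1, (φ (sliceIn (f b) (f a) T) : H' →L[ℂ] K') i.1⟫) := by
      refine Finset.sum_congr rfl fun i hi => Finset.sum_congr rfl fun j hj => ?_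
      rw [sliceIn_expand T f (hexp _ (Finset.mem_union_right _ (Finset.mem_image_of_mem _ hj)))
        (hexp _ (Finset.mem_union_left _ (Finset.mem_image_of_mem _ hi))), map_sum]
      simp only [map_sum, map_smul, Submodule.coe_sum, Submodule.coe_smul, sum_apply,
        smul_apply, inner_sum, inner_smul_right, Finset.mul_sum, map_mul]
      refine Finset.sum_congr rfl fun b _ => Finset.sum_congr rfl fun a _ => ?_
      ring
    rw [h1, h2, Finset.sum_comm]
    rw [Finset.sum_congr rfl fun j _ => Finset.sum_comm]
    rw [Finset.sum_comm]
    refine Finset.sum_congr rfl fun b _ => ?_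
    rw [Finset.sum_congr rfl fun j _ => Finset.sum_comm]
    rw [Finset.sum_comm]
  rw [hu, hv, hA, norm_rowL hf, norm_rowL hf]
  have h3 : ‖matOn A‖ ≤ ‖(T : H ⊗ₕ h →L[ℂ] K ⊗ₕ h)‖ := norm_matOp_slice_le hf _
  calc ‖⟪v, matOn (A.map φ) u⟫‖ ≤ ‖v‖ * (‖matOn (A.map φ)‖ * ‖u‖) :=
        (norm_inner_le_norm _ _).trans (by gcongr; exact ContinuousLinearMap.le_opNorm _ _)
    _ ≤ ‖v‖ * ((|C| * ‖(T : H ⊗ₕ h →L[ℂ] K ⊗ₕ h)‖) * ‖u‖) := by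
        gcongr
        exact (hC n A).trans (by gcongr; exact le_abs_self C)
    _ = _ := by ring

/-- A bounded operator with the prescribed slices. -/
lemma exists_operator (hφ : IsCB φ) : ∃ R : H' ⊗ₕ h →L[ℂ] K' ⊗ₕ h,
    ∀ e d : h, slice e d R = φ (sliceIn e d T) := by
  obtain ⟨C, hC⟩ := hφ
  let cH := Finsupp.linearCombination ℂ (fun p : H' × h => tm p.1 p.2)
  let cK := Finsupp.linearCombination ℂ (fun p : K' × h => tm p.1 p.2)
  have dH : DenseRange cH := isTotal_tm_id.denseRange
  have dK : DenseRange cK := isTotal_tm_id.denseRange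
  let M : ℝ := |C| * ‖(T : H ⊗ₕ h →L[ℂ] K ⊗ₕ h)‖
  have hM : 0 ≤ M := by positivity
  let ℓ : (H' × h →₀ ℂ) → (K' × h →₀ ℂ) →ₗ[ℂ] ℂ := fun x =>
    Finsupp.linearCombination ℂ fun j : K' × h => starRingEnd ℂ
      (∑ i ∈ x.support, x i * ⟪j.1, (φ (sliceIn j.2 i.2 T) : H' →L[ℂ] K') i.1⟫)
  have hℓ : ∀ x y, ℓ x y = starRingEnd ℂ (liftForm φ T x y) := by
    intro x y
    simp only [ℓ, Finsupp.linearCombination_apply, Finsupp.sum, liftForm]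
    rw [Finset.sum_comm, map_sum]
    refine Finset.sum_congr rfl fun j _ => ?_
    simp [Finset.mul_sum]
  have hb : ∀ x y, ‖ℓ x y‖ ≤ (M * ‖cH x‖) * ‖cK y‖ := by
    intro x y
    rw [hℓ, RCLike.norm_conj]
    exact norm_liftForm_le φ T hC x y
  let G : (H' × h →₀ ℂ) → K' ⊗ₕ h := fun x =>
    (InnerProductSpace.toDual ℂ (K' ⊗ₕ h)).symm ((ℓ x).extendOfNorm cK)
  have hG : ∀ x (v : K') (e : h), ⟪tm v e, G x⟫ =
      Finsupp.linearCombination ℂ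
        (fun i : H' × h => ⟪v, (φ (sliceIn e i.2 T) : H' →L[ℂ] K') i.1⟫) x := by
    intro x v e
    have h1 : ⟪G x, cK (Finsupp.single (v, e) 1)⟫ = ℓ x (Finsupp.single (v, e) 1) := by
      rw [InnerProductSpace.toDual_symm_apply]
      exact LinearMap.extendOfNorm_eq dK ⟨_, hb x⟩ _
    have h2 : cK (Finsupp.single (v, e) 1) = tm v e := by simp [cK]
    rw [h2] at h1
    rw [← inner_conj_symm, h1]
    simp [ℓ, Finsupp.linearCombination_apply, Finsupp.sum]
  have hGn : ∀ x, ‖G x‖ ≤ M * ‖cH x‖ := by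
    intro x
    rw [LinearIsometryEquiv.norm_map]
    exact LinearMap.opNorm_extendOfNorm_le dK (by positivity) (hb x)
  have hext : ∀ a b : K' ⊗ₕ h, (∀ (v : K') (e : h), ⟪tm v e, a⟫ = ⟪tm v e, b⟫) → a = b := by
    intro a b hab
    refine (isTotal_tm_id (H := K') (K := h)).eq_of_inner_right (𝕜 := ℂ) fun z hz => ?_
    induction hz using Submodule.span_induction with
    | mem x hx => obtain ⟨p, rfl⟩ := hx; exact hab p.1 p.2
    | zero => simp
    | add x y _ _ hx hy => rw [inner_add_left, inner_add_left, hx, hy]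
    | smul c x _ hx => rw [inner_smul_left, inner_smul_left, hx]
  let Gl : (H' × h →₀ ℂ) →ₗ[ℂ] K' ⊗ₕ h :=
    { toFun := G
      map_add' := fun x y => hext _ _ fun v e => by
        rw [inner_add_right, hG, hG, hG, map_add]
      map_smul' := fun c x => hext _ _ fun v e => by
        rw [RingHom.id_apply, inner_smul_right, hG, hG, map_smul, smul_eq_mul] }
  let R := Gl.extendOfNorm cH
  refine ⟨R, fun e d => ContinuousLinearMap.ext fun u => ext_inner_left ℂ fun v => ?_⟩
  rw [inner_slice]
  have h3 : cH (Finsupp.single (u, d) 1) = tm u d := by simp [cH]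
  have h4 : R (cH (Finsupp.single (u, d) 1)) = G (Finsupp.single (u, d) 1) :=
    LinearMap.extendOfNorm_eq (f := Gl) dH ⟨M, hGn⟩ _
  rw [← h3, h4, hG]
  simp

end Existence

/-- A completely bounded map has a lifting. -/
lemma exists_lifting (φ : V →ₗ[ℂ] W) (hφ : IsCB φ) :
    ∃ Φ : matrixSpace V h →ₗ[ℂ] matrixSpace W h, IsLifting φ Φ := by
  choose R hR using fun T : matrixSpace V h => exists_operator φ T hφ
  refine ⟨{ toFun := fun T => ⟨R T, fun d e => by rw [hR]; exact (φ _).2⟩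
            map_add' := fun S T => Subtype.ext (ext_slice fun d e => ?_)
            map_smul' := fun c T => Subtype.ext (ext_slice fun d e => ?_) }, fun T d e => ?_⟩
  · simp only [Submodule.coe_add, map_add, hR]
  · simp only [Submodule.coe_smul, map_smul, hR, RingHom.id_apply]
  · exact Subtype.ext (hR T d e)

/-- A map has at most one lifting. -/
lemma IsLifting.unique {φ : V →ₗ[ℂ] W} {Φ Ψ : matrixSpace V h →ₗ[ℂ] matrixSpace W h}
    (hΦ : IsLifting φ Φ) (hΨ : IsLifting φ Ψ) : Φ = Ψ :=
  LinearMap.ext fun T => Subtype.ext (ext_slice fun d e =>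
    congrArg Subtype.val ((hΦ T d e).trans (hΨ T d e).symm))

open Classical in
variable (h) in
/-- The matrix-space lifting `φ ⊗_M id_{B(h)}` of a completely bounded map `φ`, which is the only
lifting of `φ`. -/
def lifting (φ : V →ₗ[ℂ] W) : matrixSpace V h →ₗ[ℂ] matrixSpace W h :=
  if hφ : ∃ Φ : matrixSpace V h →ₗ[ℂ] matrixSpace W h, IsLifting φ Φ then hφ.choose else 0

lemma isLifting_lifting (φ : V →ₗ[ℂ] W) (hφ : IsCB φ) : IsLifting φ (lifting h φ) := by
  have hx := exists_lifting (h := h) φ hφ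
  rw [lifting, dif_pos hx]
  exact hx.choose_spec

/-- Conjugation of operators by a pair of unitaries. -/
def conjOp {A A' B B' : Type*} [NormedAddCommGroup A] [InnerProductSpace ℂ A]
    [NormedAddCommGroup A'] [InnerProductSpace ℂ A'] [NormedAddCommGroup B]
    [InnerProductSpace ℂ B] [NormedAddCommGroup B'] [InnerProductSpace ℂ B']
    (U : A ≃ₗᵢ[ℂ] A') (U' : B ≃ₗᵢ[ℂ] B') : (A →L[ℂ] B) →ₗ[ℂ] (A' →L[ℂ] B') where
  toFun T := U'.toContinuousLinearEquiv.toContinuousLinearMap ∘L T ∘L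
    U.symm.toContinuousLinearEquiv.toContinuousLinearMap
  map_add' S T := by ext; simp
  map_smul' c T := by ext; simp

end Operators

/-! ### Adaptedness and shifts -/

section Adapted

variable {H : Type*} {K : Type*} {κ : Type*}
  [NormedAddCommGroup H] [InnerProductSpace ℂ H]
  [NormedAddCommGroup K] [InnerProductSpace ℂ K] [CompleteSpace K]
  [NormedAddCommGroup κ] [InnerProductSpace ℂ κ]

variable (H) in
/-- The identification `(H ⊗ Fock s) ⊗ Fock t = H ⊗ Fock R` when `R` is split into `s` and `t`. -/
def assemble {R s t : Set ℝ} (S : Split R s t) :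
    (H ⊗ₕ FockOn κ s) ⊗ₕ FockOn κ t ≃ₗᵢ[ℂ] H ⊗ₕ FockOn κ R :=
  (tassoc H (FockOn κ s) (FockOn κ t)).trans
    (tcongr (LinearIsometryEquiv.refl ℂ H) (fockSplit S))

lemma assemble_tm {R s t : Set ℝ} (S : Split R s t) (u : H) (ξ : FockOn κ s) (η : FockOn κ t) :
    assemble H S (tm (tm u ξ) η) = tm u (fockSplit S (tm ξ η)) := by
  rw [assemble, LinearIsometryEquiv.trans_apply, tassoc_tm, tcongr_tm]
  rfl

/-- The ampliation `T ↦ T ⊗ I_{Fock t}`, from operators `H ⊗ Fock s → K ⊗ Fock s` to operators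
`H ⊗ Fock R → K ⊗ Fock R`, when `R` is split into `s` and `t`. -/
def ampliate {R s t : Set ℝ} (S : Split R s t) (T : H ⊗ₕ FockOn κ s →L[ℂ] K ⊗ₕ FockOn κ s) :
    H ⊗ₕ FockOn κ R →L[ℂ] K ⊗ₕ FockOn κ R :=
  conjOp (assemble H S) (assemble K S) (tmap T (ContinuousLinearMap.id ℂ (FockOn κ t)))

/-- The operator `T` belongs to `V ⊗_M B(Fock [0, t[) ⊗ I_{[t, ∞[}`. -/
def IsAdapted (V : Submodule ℂ (H →L[ℂ] K)) (t : ℝ≥0)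
    (T : H ⊗ₕ FockOn κ axis →L[ℂ] K ⊗ₕ FockOn κ axis) : Prop :=
  ∃ S ∈ matrixSpace V (FockOn κ (before t)), T = ampliate (cut t) S

/-- The shift as a map from operators `H ⊗ Fock [0, ∞[ → K ⊗ Fock [0, ∞[` to operators
`H ⊗ Fock [r, ∞[ → K ⊗ Fock [r, ∞[`. -/
def shiftOp (r : ℝ≥0) : (H ⊗ₕ FockOn κ axis →L[ℂ] K ⊗ₕ FockOn κ axis) →ₗ[ℂ]
    (H ⊗ₕ FockOn κ (after r) →L[ℂ] K ⊗ₕ FockOn κ (after r)) :=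
  conjOp (tcongr (LinearIsometryEquiv.refl ℂ H) (shiftFock κ r))
    (tcongr (LinearIsometryEquiv.refl ℂ K) (shiftFock κ r))

/-- The ampliated CCR flow `σ_r = id ⊗ σ_r^κ`, as an endomorphism of the operators
`H ⊗ Fock [0, ∞[ → K ⊗ Fock [0, ∞[`: shift by `r` and ampliate with the identity
of `Fock [0, r[`. -/
def ccrFlow (r : ℝ≥0) (T : H ⊗ₕ FockOn κ axis →L[ℂ] K ⊗ₕ FockOn κ axis) :
    H ⊗ₕ FockOn κ axis →L[ℂ] K ⊗ₕ FockOn κ axis :=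
  ampliate (cut r).swap (shiftOp r T)

lemma conjOp_apply' {A A' B B' : Type*} [NormedAddCommGroup A] [InnerProductSpace ℂ A]
    [NormedAddCommGroup A'] [InnerProductSpace ℂ A'] [NormedAddCommGroup B]
    [InnerProductSpace ℂ B] [NormedAddCommGroup B'] [InnerProductSpace ℂ B']
    (U : A ≃ₗᵢ[ℂ] A') (U' : B ≃ₗᵢ[ℂ] B') (T : A →L[ℂ] B) (x : A') :
    conjOp U U' T x = U' (T (U.symm x)) := rfl

lemma slice_shiftOp (r : ℝ≥0) (T : H ⊗ₕ FockOn κ axis →L[ℂ] K ⊗ₕ FockOn κ axis)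
    (d e : FockOn κ (after r)) :
    slice d e (shiftOp r T) = slice ((shiftFock κ r).symm d) ((shiftFock κ r).symm e) T := by
  have key : ∀ {M : Type _} [NormedAddCommGroup M] [InnerProductSpace ℂ M] (u : M)
      (d : FockOn κ (after r)),
      (tcongr (LinearIsometryEquiv.refl ℂ M) (shiftFock κ r)).symm (tm u d) =
        tm u ((shiftFock κ r).symm d) := by
    intro M _ _ u d
    rw [LinearIsometryEquiv.symm_apply_eq, tcongr_tm]
    simp
  refine ContinuousLinearMap.ext fun u => ext_inner_left ℂ fun v => ?_
  rw [inner_slice, inner_slice, shiftOp, conjOp_apply', key]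
  rw [← LinearIsometryEquiv.inner_map_map
    (tcongr (LinearIsometryEquiv.refl ℂ K) (shiftFock κ r)) (tm v _), tcongr_tm]
  simp

variable (V : Submodule ℂ (H →L[ℂ] K))

/-- The shift `V ⊗_M B(Fock [0, ∞[) → V ⊗_M B(Fock [r, ∞[)`; the target is identified with the
range of `σ_r`. -/
def shiftMap (r : ℝ≥0) :
    matrixSpace V (FockOn κ axis) →ₗ[ℂ] matrixSpace V (FockOn κ (after r)) :=
  (shiftOp r).restrict fun T hT d e => by rw [slice_shiftOp]; exact hT _ _

/-- The vacuum conditional expectation onto operators `H ⊗ Fock [0, r[ → K ⊗ Fock [0, r[`; it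
inverts the ampliation `T ↦ T ⊗ I_{[r, ∞[}`. -/
def pastOp (r : ℝ≥0) : (H ⊗ₕ FockOn κ axis →L[ℂ] K ⊗ₕ FockOn κ axis) →ₗ[ℂ]
    (H ⊗ₕ FockOn κ (before r) →L[ℂ] K ⊗ₕ FockOn κ (before r)) :=
  slice (expVec 0) (expVec 0) ∘ₗ conjOp (assemble H (cut r)).symm (assemble K (cut r)).symm

lemma slice_pastOp (r : ℝ≥0) (T : H ⊗ₕ FockOn κ axis →L[ℂ] K ⊗ₕ FockOn κ axis)
    (d e : FockOn κ (before r)) :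
    slice d e (pastOp r T) =
      slice (fockSplit (cut r) (tm d (expVec 0))) (fockSplit (cut r) (tm e (expVec 0))) T := by
  refine ContinuousLinearMap.ext fun u => ext_inner_left ℂ fun v => ?_
  rw [inner_slice, inner_slice, pastOp, LinearMap.comp_apply, inner_slice, conjOp_apply',
    LinearIsometryEquiv.symm_symm, assemble_tm, ← assemble_tm,
    ← LinearIsometryEquiv.inner_map_map (assemble K (cut r)) (tm (tm v d) (expVec 0)),
    LinearIsometryEquiv.apply_symm_apply, assemble_tm, assemble_tm]

lemma pastOp_ampliate (r : ℝ≥0) (S : H ⊗ₕ FockOn κ (before r) →L[ℂ] K ⊗ₕ FockOn κ (before r)) :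
    pastOp r (ampliate (cut r) S) = S := by
  refine ContinuousLinearMap.ext fun x => ext_inner_left ℂ fun y => ?_
  rw [pastOp, LinearMap.comp_apply, inner_slice, conjOp_apply', ampliate, conjOp_apply']
  rw [LinearIsometryEquiv.symm_symm, LinearIsometryEquiv.symm_apply_apply,
    LinearIsometryEquiv.symm_apply_apply, tmap_tm, inner_tm, ContinuousLinearMap.id_apply,
    inner_expVec, inner_zero_left, Complex.exp_zero, mul_one]

/-- The vacuum conditional expectation `V ⊗_M B(Fock [0, ∞[) → V ⊗_M B(Fock [0, r[)`. -/
def pastMap (r : ℝ≥0) :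
    matrixSpace V (FockOn κ axis) →ₗ[ℂ] matrixSpace V (FockOn κ (before r)) :=
  (pastOp r).restrict fun T hT d e => by rw [slice_pastOp]; exact hT _ _

lemma norm_assemble_vacuum {n : ℕ} (r : ℝ≥0)
    (x : PiLp 2 fun _ : Fin n => H ⊗ₕ FockOn κ (before r)) :
    ‖(WithLp.toLp 2 fun i => assemble H (cut r) (tm (x i) (expVec 0)) :
      PiLp 2 fun _ : Fin n => H ⊗ₕ FockOn κ axis)‖ = ‖x‖ := by
  have h0 : ‖(expVec 0 : FockOn κ (after r))‖ = 1 := by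
    rw [@norm_eq_sqrt_re_inner ℂ, inner_expVec, inner_zero_left, Complex.exp_zero]
    simp
  rw [PiLp.norm_eq_of_L2, PiLp.norm_eq_of_L2]
  simp only [LinearIsometryEquiv.norm_map, norm_tm, h0, mul_one]

lemma norm_matOp_pastOp_le {n : ℕ} (r : ℝ≥0)
    (A : Matrix (Fin n) (Fin n) (H ⊗ₕ FockOn κ axis →L[ℂ] K ⊗ₕ FockOn κ axis)) :
    ‖matOp (A.map (pastOp r))‖ ≤ ‖matOp A‖ := by
  refine ContinuousLinearMap.opNorm_le_bound _ (norm_nonneg (matOp A)) fun x => ?_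
  set z := matOp (A.map (pastOp r)) x with hz
  set x' : PiLp 2 fun _ : Fin n => H ⊗ₕ FockOn κ axis :=
    WithLp.toLp 2 fun i => assemble H (cut r) (tm (x i) (expVec 0)) with hx'
  set z' : PiLp 2 fun _ : Fin n => K ⊗ₕ FockOn κ axis :=
    WithLp.toLp 2 fun i => assemble K (cut r) (tm (z i) (expVec 0)) with hz'
  have h2 : ⟪z, z⟫ = ⟪z', matOp A x'⟫ := by
    conv_lhs => rw [PiLp.inner_apply]
    rw [PiLp.inner_apply]
    refine Finset.sum_congr rfl fun i _ => ?_
    have h3 : z i = ∑ j, pastOp r (A i j) (x j) := matOp_apply _ _ _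
    have h4 : ∀ y, ⟪y, z i⟫ = ∑ j, ⟪y, pastOp r (A i j) (x j)⟫ := fun y => by
      rw [h3, inner_sum]
    rw [h4, matOp_apply A x' i, inner_sum]
    refine Finset.sum_congr rfl fun j _ => ?_
    rw [pastOp, LinearMap.comp_apply, inner_slice, conjOp_apply', LinearIsometryEquiv.symm_symm,
      ← LinearIsometryEquiv.inner_map_map (assemble K (cut r)) (tm (z i) (expVec 0)),
      LinearIsometryEquiv.apply_symm_apply]
  have h1 : ‖z‖ * ‖z‖ ≤ ‖z‖ * (‖matOp A‖ * ‖x‖) := by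
    calc ‖z‖ * ‖z‖ = ‖⟪z, z⟫‖ := by
          rw [inner_self_eq_norm_sq_to_K]; simp [sq]
      _ = ‖⟪z', matOp A x'⟫‖ := by rw [h2]
      _ ≤ ‖z'‖ * ‖matOp A x'‖ := norm_inner_le_norm _ _
      _ ≤ ‖z'‖ * (‖matOp A‖ * ‖x'‖) := by gcongr; exact (matOp A).le_opNorm x'
      _ = ‖z‖ * (‖matOp A‖ * ‖x‖) := by rw [hx', hz', norm_assemble_vacuum, norm_assemble_vacuum]
  rcases (norm_nonneg z).eq_or_lt with h0 | h0
  · rw [← h0]; positivity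
  · exact le_of_mul_le_mul_left h1 h0

variable {V} in
lemma IsCB.past {H' K' : Type*} [NormedAddCommGroup H'] [InnerProductSpace ℂ H']
    [NormedAddCommGroup K'] [InnerProductSpace ℂ K'] {U : Submodule ℂ (H' →L[ℂ] K')}
    {φ : U →ₗ[ℂ] matrixSpace V (FockOn κ axis)} (hφ : IsCB φ) (r : ℝ≥0) :
    IsCB (pastMap V r ∘ₗ φ) := by
  obtain ⟨C, hC⟩ := hφ
  exact ⟨C, fun n A => (norm_matOp_pastOp_le r _).trans (hC n A)⟩

end Adapted

/-! ### Quantum stochastic cocycles -/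

section Cocycles

variable {H : Type*} {K : Type*} {κ : Type*}
  [NormedAddCommGroup H] [InnerProductSpace ℂ H]
  [NormedAddCommGroup K] [InnerProductSpace ℂ K] [CompleteSpace K]
  [NormedAddCommGroup κ] [InnerProductSpace ℂ κ]

/-- For a process `k` on `V`, the map `k̂_r = k_r ⊗_M id` on `V ⊗_M B(Fock [r, ∞[)`. Here `k_r` is
viewed as a map `V → V ⊗_M B(Fock [0, r[)`, which is completely bounded if `k_r` is, and the values of `k̂_r`, which are elements of
`(V ⊗_M B(Fock [0, r[)) ⊗_M B(Fock [r, ∞[)`, are viewed as operators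
`H ⊗ Fock [0, ∞[ → K ⊗ Fock [0, ∞[`. -/
def hat {V : Submodule ℂ (H →L[ℂ] K)} (k : ℝ≥0 → V →ₗ[ℂ] matrixSpace V (FockOn κ axis)) (r : ℝ≥0)
    (T : matrixSpace V (FockOn κ (after r))) :
    H ⊗ₕ FockOn κ axis →L[ℂ] K ⊗ₕ FockOn κ axis :=
  conjOp (assemble H (cut r)) (assemble K (cut r))
    (lifting (FockOn κ (after r)) (pastMap V r ∘ₗ k r) T)

/-- `k` is a (completely bounded) quantum stochastic cocycle on the operator space `V`, with noise
dimension space `κ`. -/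
structure IsCocycle (V : Submodule ℂ (H →L[ℂ] K))
    (k : ℝ≥0 → V →ₗ[ℂ] matrixSpace V (FockOn κ axis)) : Prop where
  cb : ∀ t, IsCB (k t)
  adapted : ∀ t a, IsAdapted V t (k t a : H ⊗ₕ FockOn κ axis →L[ℂ] K ⊗ₕ FockOn κ axis)
  zero : ∀ a : V, (k 0 a : H ⊗ₕ FockOn κ axis →L[ℂ] K ⊗ₕ FockOn κ axis) =
    tmap (a : H →L[ℂ] K) (ContinuousLinearMap.id ℂ (FockOn κ axis))
  add : ∀ (r t : ℝ≥0) (a : V), (k (r + t) a : H ⊗ₕ FockOn κ axis →L[ℂ] K ⊗ₕ FockOn κ axis) =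
    hat k r (shiftMap V r (k t a))

/-- An operator space in `B(H; K)`: a norm-closed subspace. -/
def IsOperatorSpace (V : Submodule ℂ (H →L[ℂ] K)) : Prop := IsClosed (V : Set (H →L[ℂ] K))

/-- An operator system in `B(K)`: a norm-closed subspace which is closed under adjoints and
contains the identity. -/
structure IsOperatorSystem (V : Submodule ℂ (K →L[ℂ] K)) : Prop where
  closed : IsOperatorSpace V
  adjoint_mem : ∀ a ∈ V, ContinuousLinearMap.adjoint a ∈ V
  one_mem : 1 ∈ V

/-- `X` is a bounded quantum stochastic process on the Hilbert space `K`. -/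
def IsProcess (X : ℝ≥0 → K ⊗ₕ FockOn κ axis →L[ℂ] K ⊗ₕ FockOn κ axis) : Prop :=
  ∀ t, IsAdapted ⊤ t (X t)

/-- `X` is a bounded left quantum stochastic (operator) cocycle on `K`. -/
structure IsLeftCocycle (X : ℝ≥0 → K ⊗ₕ FockOn κ axis →L[ℂ] K ⊗ₕ FockOn κ axis) : Prop where
  process : IsProcess X
  zero : X 0 = 1
  add : ∀ r t, X (r + t) = X r ∘L ccrFlow r (X t)

/-- `X` is a bounded right quantum stochastic (operator) cocycle on `K`. -/
structure IsRightCocycle (X : ℝ≥0 → K ⊗ₕ FockOn κ axis →L[ℂ] K ⊗ₕ FockOn κ axis) : Prop where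
  process : IsProcess X
  zero : X 0 = 1
  add : ∀ r t, X (r + t) = ccrFlow r (X t) ∘L X r

end Cocycles

/-- A set of times is empty or all of `]0, ∞[`. -/
def Dichotomy (S : Set ℝ≥0) : Prop := S = ∅ ∨ S = Set.Ioi 0

end QS

end

noncomputable section

namespace QS

/-! Each set is controlled by two facts about a property P of times: P survives sums, and P(r + t)
forces P at one of r and t. Addition of times is commutative, so the second fact makes P downward
closed whichever of the two inherits it. One time T > 0 with P then gives P at every multiple of T,
and below those at every time (`dichotomy_of_add`).

Inheritance is read off the factorisation. In k_{r+t} = k̂_r ∘ σ_r ∘ k_t the map k_t acts first, so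
it is injective if the composite is; for complete contractions, ‖A‖ = ‖k_{r+t}(A)‖ ≤ ‖k_t(A)‖ ≤ ‖A‖
at every matrix level. For operators it is again the factor acting first that inherits: σ_r(X_t) for
a left cocycle, X_r for a right one. Adjoints exchange the two composition laws, which reduces the
coisometric case to the isometric one. Unitality passes instead to the outer map: from j_t(1) ≤ 1
follows 1 = ĵ_r(σ_r(j_t(1))) ≤ ĵ_r(1) = j_r(1) ≤ 1.

Underneath, properties must pass from X_t to σ_r(X_t) and from k_r to k̂_r. The flow is an
ampliation between unitary conjugations, hence a faithful unital *-homomorphism. For a lifting,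
operators are determined by their slices, and norms or positivity may be tested on finite sums of
elementary tensors. The second legs occurring there span a finite-dimensional space; an orthonormal
basis of it turns the test into one on a larger matrix of slices, on which the lifting acts as the
original map entrywise (`norm_matOp_le_of_blockSlice`, `IsLifting.isCI`, `IsLifting.isPositive`).
Finally, k_r may be replaced by its vacuum compression to [0, r[, because adaptedness lets
ampliation undo that compression (`IsCocycle.ampliate_pastMap`). -/

/-! ### Additive sets of times -/

/-- A property of times which is inherited by sums and by one of the two parts of any splitting
holds either at no strictly positive time or at all of them. -/
lemma dichotomy_of_add {P : ℝ≥0 → Prop} (hadd : ∀ r t, P r → P t → P (r + t))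
    (hle : ∀ r t, r ≤ t → P t → P r) : Dichotomy {t | 0 < t ∧ P t} := by
  rcases Set.eq_empty_or_nonempty {t | 0 < t ∧ P t} with h | ⟨T, hT, hP⟩
  · exact Or.inl h
  · have hmul : ∀ n : ℕ, P ((n + 1) • T) := by
      intro n
      induction n with
      | zero => simpa using hP
      | succ n ih => rw [succ_nsmul]; exact hadd _ _ ih hP
    refine Or.inr (Set.ext fun t => ⟨fun h => h.1, fun h => ⟨h, ?_⟩⟩)
    obtain ⟨n, hn⟩ := Archimedean.arch t hT
    exact hle _ _ (hn.trans (nsmul_le_nsmul_left hT.le (Nat.le_succ n))) (hmul n)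

/-- The splitting t = r + (t - r) is exact because r ≤ t. This form serves right operator cocycles
and unitality. -/
lemma dichotomy_of_add_left {P : ℝ≥0 → Prop} (hadd : ∀ r t, P r → P t → P (r + t))
    (hl : ∀ r t, P (r + t) → P r) : Dichotomy {t | 0 < t ∧ P t} :=
  dichotomy_of_add hadd fun r t hrt h => hl r (t - r) (by rwa [add_tsub_cancel_of_le hrt])

/-- The same splitting with the summands exchanged. This form serves left operator cocycles, and
injectivity and complete isometry of mapping cocycles. -/
lemma dichotomy_of_add_right {P : ℝ≥0 → Prop} (hadd : ∀ r t, P r → P t → P (r + t))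
    (hr : ∀ r t, P (r + t) → P t) : Dichotomy {t | 0 < t ∧ P t} :=
  dichotomy_of_add hadd fun r t hrt h => hr (t - r) r (by rwa [tsub_add_cancel_of_le hrt])

/-! ### Ampliations -/

section Ampliation

variable {H K M h : Type*}
  [NormedAddCommGroup H] [InnerProductSpace ℂ H]
  [NormedAddCommGroup K] [InnerProductSpace ℂ K]
  [NormedAddCommGroup M] [InnerProductSpace ℂ M]
  [NormedAddCommGroup h] [InnerProductSpace ℂ h]

/-- Operators which agree on elementary tensors are equal. -/
lemma ext_tm {S T : H ⊗ₕ h →L[ℂ] M} (hST : ∀ u e, S (tm u e) = T (tm u e)) : S = T := by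
  refine ContinuousLinearMap.ext_on (isTotal_tm_id (H := H) (K := h)) ?_
  rintro _ ⟨p, rfl⟩
  exact hST p.1 p.2

/-- Vectors with equal inner products against elementary tensors are equal. -/
lemma ext_inner_tm {x y : H ⊗ₕ h} (hxy : ∀ u e, ⟪tm u e, x⟫ = ⟪tm u e, y⟫) : x = y := by
  have h1 : innerSL ℂ x = innerSL ℂ y := ext_tm fun u e => by
    rw [innerSL_apply_apply, innerSL_apply_apply, ← inner_conj_symm, hxy, inner_conj_symm]
  exact ext_inner_right ℂ fun z => by
    simpa only [innerSL_apply_apply] using! congrArg (fun S => S z) h1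

lemma tmap_comp {H' K' M' : Type*} [NormedAddCommGroup H'] [InnerProductSpace ℂ H']
    [NormedAddCommGroup K'] [InnerProductSpace ℂ K'] [NormedAddCommGroup M']
    [InnerProductSpace ℂ M'] (A : K →L[ℂ] M) (B : K' →L[ℂ] M') (C : H →L[ℂ] K)
    (D : H' →L[ℂ] K') : tmap A B ∘L tmap C D = tmap (A ∘L C) (B ∘L D) :=
  ext_tm fun u e => by
    simp only [ContinuousLinearMap.comp_apply, tmap_tm]

lemma tmap_id : tmap (ContinuousLinearMap.id ℂ H) (ContinuousLinearMap.id ℂ h) =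
    ContinuousLinearMap.id ℂ (H ⊗ₕ h) :=
  ext_tm fun u e => by simp only [ContinuousLinearMap.id_apply, tmap_tm]

lemma norm_tmap_id_le (A : H →L[ℂ] K) : ‖tmap A (ContinuousLinearMap.id ℂ h)‖ ≤ ‖A‖ := by
  refine LinearMap.opNorm_extendOfNorm_le denseRange_tincl (norm_nonneg A) fun x => ?_
  change ‖tincl (TensorProduct.mapL A (ContinuousLinearMap.id ℂ h) x)‖ ≤ ‖A‖ * ‖tincl x‖
  rw [LinearIsometry.norm_map, LinearIsometry.norm_map]
  refine ContinuousLinearMap.le_of_opNorm_le _ ((TensorProduct.norm_mapL_le _ _).trans ?_) x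
  exact mul_le_of_le_one_right (norm_nonneg A) ContinuousLinearMap.norm_id_le

/-- If A kills u, its ampliation kills u ⊗ e, whose norm is ‖u‖ ‖e‖ with ‖e‖ ≠ 0. -/
lemma injective_of_tmap_id {A : H →L[ℂ] K} {e : h} (he : e ≠ 0)
    (hA : Function.Injective (tmap A (ContinuousLinearMap.id ℂ h))) : Function.Injective A := by
  rw [injective_iff_map_eq_zero]
  intro u hu
  have h1 : tm u e = 0 := hA (by
    rw [tmap_tm, hu, map_zero, ← tmL_apply, map_zero, zero_apply])
  have h2 := norm_tm u e
  rw [h1, norm_zero, eq_comm, mul_eq_zero] at h2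
  exact norm_eq_zero.1 (h2.resolve_right (norm_ne_zero_iff.2 he))

lemma tmap_id_injective {e : h} (he : e ≠ 0) {A B : H →L[ℂ] K}
    (hAB : tmap A (ContinuousLinearMap.id ℂ h) = tmap B (ContinuousLinearMap.id ℂ h)) :
    A = B := by
  refine ContinuousLinearMap.ext fun u => ?_
  have h1 : tm (A u - B u) e = 0 := by
    have h2 := congrArg (fun S => S (tm u e)) hAB
    simp only [tmap_tm, ContinuousLinearMap.id_apply] at h2
    rw [← tmL_apply, map_sub, sub_apply, tmL_apply, tmL_apply, h2, sub_self]
  have h2 := norm_tm (A u - B u) e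
  rw [h1, norm_zero, eq_comm, mul_eq_zero] at h2
  exact sub_eq_zero.1 (norm_eq_zero.1 (h2.resolve_right (norm_ne_zero_iff.2 he)))

variable [CompleteSpace K]

/-- For orthonormal vectors the off-diagonal slices of an ampliation vanish and the diagonal ones
return the operator. -/
lemma slice_tmap_id (A : H →L[ℂ] K) (d e : h) :
    slice d e (tmap A (ContinuousLinearMap.id ℂ h)) = ⟪d, e⟫ • A := by
  refine ContinuousLinearMap.ext fun u => ext_inner_left ℂ fun v => ?_
  rw [inner_slice, tmap_tm, inner_tm, smul_apply, inner_smul_right, mul_comm]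
  rfl

variable [CompleteSpace H]

lemma adjoint_tmap_id (A : H →L[ℂ] K) :
    ContinuousLinearMap.adjoint (tmap A (ContinuousLinearMap.id ℂ h)) =
      tmap (ContinuousLinearMap.adjoint A) (ContinuousLinearMap.id ℂ h) :=
  ext_tm fun v d => ext_inner_tm fun u e => by
    rw [ContinuousLinearMap.adjoint_inner_right, tmap_tm, tmap_tm, inner_tm, inner_tm,
      ContinuousLinearMap.adjoint_inner_right]
    rfl

/-- The intertwining relation E^d (A ⊗ I) = A E^d, checked on elementary tensors; it lets kernels of
ampliations be studied one slice at a time. -/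
lemma emb_adjoint_tmap_id (A : H →L[ℂ] K) (d : h) (x : H ⊗ₕ h) :
    ContinuousLinearMap.adjoint (emb d) (tmap A (ContinuousLinearMap.id ℂ h) x) =
      A (ContinuousLinearMap.adjoint (emb d) x) := by
  have h1 : ContinuousLinearMap.adjoint (emb d) ∘L tmap A (ContinuousLinearMap.id ℂ h) =
      A ∘L ContinuousLinearMap.adjoint (emb d) := by
    refine ext_tm fun u e => ext_inner_left ℂ fun v => ?_
    rw [ContinuousLinearMap.comp_apply, ContinuousLinearMap.comp_apply,
      ContinuousLinearMap.adjoint_inner_right, tmap_tm]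
    change ⟪tm v d, _⟫ = _
    rw [inner_tm, ← ContinuousLinearMap.adjoint_inner_left A,
      ← ContinuousLinearMap.adjoint_inner_left A, ContinuousLinearMap.adjoint_inner_right]
    change _ = ⟪tm _ d, _⟫
    rw [inner_tm]
    rfl
  exact congrArg (fun S => S x) h1

/-- The ampliation of an injective operator is injective. -/
lemma injective_tmap_id {A : H →L[ℂ] K} (hA : Function.Injective A) :
    Function.Injective (tmap A (ContinuousLinearMap.id ℂ h)) := by
  rw [injective_iff_map_eq_zero]
  intro x hx
  refine ext_inner_tm fun u e => ?_
  -- Every slice E^e x lies in the kernel of A, hence vanishes, and these slices determine x.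
  have h1 := emb_adjoint_tmap_id A e x
  rw [hx, map_zero] at h1
  have h2 : ContinuousLinearMap.adjoint (emb e) x = 0 := hA (by rw [← h1, map_zero])
  change ⟪emb e u, x⟫ = _
  rw [← ContinuousLinearMap.adjoint_inner_right, h2, inner_zero_right, inner_zero_right]

end Ampliation

/-! ### Conjugation by unitaries -/

section Conjugation

variable {A A' B B' C C' : Type*}
  [NormedAddCommGroup A] [InnerProductSpace ℂ A] [NormedAddCommGroup A'] [InnerProductSpace ℂ A']
  [NormedAddCommGroup B] [InnerProductSpace ℂ B] [NormedAddCommGroup B'] [InnerProductSpace ℂ B']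
  [NormedAddCommGroup C] [InnerProductSpace ℂ C] [NormedAddCommGroup C'] [InnerProductSpace ℂ C']

lemma conjOp_symm_conjOp (U : A ≃ₗᵢ[ℂ] A') (U' : B ≃ₗᵢ[ℂ] B') (T : A →L[ℂ] B) :
    conjOp U.symm U'.symm (conjOp U U' T) = T :=
  ContinuousLinearMap.ext fun x => by simp [conjOp_apply']

lemma conjOp_injective (U : A ≃ₗᵢ[ℂ] A') (U' : B ≃ₗᵢ[ℂ] B') :
    Function.Injective (conjOp U U') :=
  Function.LeftInverse.injective (conjOp_symm_conjOp U U')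

lemma conjOp_comp (U : A ≃ₗᵢ[ℂ] A') (U' : B ≃ₗᵢ[ℂ] B') (U'' : C ≃ₗᵢ[ℂ] C') (S : B →L[ℂ] C)
    (T : A →L[ℂ] B) : conjOp U U'' (S ∘L T) = conjOp U' U'' S ∘L conjOp U U' T :=
  ContinuousLinearMap.ext fun x => by simp [conjOp_apply']

lemma conjOp_id (U : A ≃ₗᵢ[ℂ] A') :
    conjOp U U (ContinuousLinearMap.id ℂ A) = ContinuousLinearMap.id ℂ A' :=
  ContinuousLinearMap.ext fun x => by simp [conjOp_apply']

lemma injective_conjOp_iff (U : A ≃ₗᵢ[ℂ] A') (U' : B ≃ₗᵢ[ℂ] B') (T : A →L[ℂ] B) :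
    Function.Injective (conjOp U U' T) ↔ Function.Injective T := by
  change Function.Injective (U' ∘ T ∘ U.symm) ↔ _
  rw [U'.injective.of_comp_iff]
  exact U.symm.toEquiv.injective_comp T

lemma norm_conjOp (U : A ≃ₗᵢ[ℂ] A') (U' : B ≃ₗᵢ[ℂ] B') (T : A →L[ℂ] B) :
    ‖conjOp U U' T‖ ≤ ‖T‖ := by
  refine ContinuousLinearMap.opNorm_le_bound _ (norm_nonneg T) fun x => ?_
  rw [conjOp_apply', LinearIsometryEquiv.norm_map]
  simpa using T.le_opNorm (U.symm x)

lemma adjoint_conjOp [CompleteSpace A] [CompleteSpace A'] [CompleteSpace B] [CompleteSpace B']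
    (U : A ≃ₗᵢ[ℂ] A') (U' : B ≃ₗᵢ[ℂ] B') (T : A →L[ℂ] B) :
    ContinuousLinearMap.adjoint (conjOp U U' T) =
      conjOp U' U (ContinuousLinearMap.adjoint T) := by
  refine ContinuousLinearMap.ext fun x => ext_inner_left ℂ fun y => ?_
  rw [ContinuousLinearMap.adjoint_inner_right, conjOp_apply', conjOp_apply',
    ← U.symm.inner_map_map y, LinearIsometryEquiv.symm_apply_apply,
    ContinuousLinearMap.adjoint_inner_right, ← U'.inner_map_map _ (U'.symm x),
    LinearIsometryEquiv.apply_symm_apply]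

lemma isPositive_conjOp (U : A ≃ₗᵢ[ℂ] A') {T : A →L[ℂ] A} (hT : T.IsPositive) :
    (conjOp U U T).IsPositive := by
  rw [ContinuousLinearMap.isPositive_iff_complex] at hT ⊢
  intro x
  have h1 : ⟪conjOp U U T x, x⟫ = ⟪T (U.symm x), U.symm x⟫ := by
    rw [conjOp_apply', ← U.inner_map_map, LinearIsometryEquiv.apply_symm_apply]
  rw [h1]
  exact hT _

variable [CompleteSpace B] [CompleteSpace B']

/-- Entrywise conjugation is composition with the diagonal unitaries diag(U') and diag(U⁻¹) on the
direct sums. -/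
lemma norm_matOp_conjOp_le {n : ℕ} (U : A ≃ₗᵢ[ℂ] A') (U' : B ≃ₗᵢ[ℂ] B')
    (T : Matrix (Fin n) (Fin n) (A →L[ℂ] B)) :
    ‖matOp (T.map (conjOp U U'))‖ ≤ ‖matOp T‖ := by
  refine ContinuousLinearMap.opNorm_le_bound _ (norm_nonneg (matOp T)) fun x => ?_
  have h2 : matOp (T.map (conjOp U U')) x =
      WithLp.toLp 2 fun i => U' (matOp T (WithLp.toLp 2 fun i => U.symm (x i)) i) := by
    ext i
    simp [matOp_apply, conjOp_apply']
  have h3 : ‖matOp (T.map (conjOp U U')) x‖ =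
      ‖matOp T (WithLp.toLp 2 fun i => U.symm (x i))‖ := by
    rw [h2]
    simp only [PiLp.norm_eq_of_L2, LinearIsometryEquiv.norm_map]
  have h4 : ‖(WithLp.toLp 2 fun i => U.symm (x i) : PiLp 2 fun _ : Fin n => A)‖ = ‖x‖ := by
    simp only [PiLp.norm_eq_of_L2, LinearIsometryEquiv.norm_map]
  rw [h3, ← h4]
  exact (matOp T).le_opNorm _

lemma norm_matOp_conjOp {n : ℕ} (U : A ≃ₗᵢ[ℂ] A') (U' : B ≃ₗᵢ[ℂ] B')
    (T : Matrix (Fin n) (Fin n) (A →L[ℂ] B)) :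
    ‖matOp (T.map (conjOp U U'))‖ = ‖matOp T‖ := by
  refine (norm_matOp_conjOp_le U U' T).antisymm ?_
  have h1 := norm_matOp_conjOp_le U.symm U'.symm (T.map (conjOp U U'))
  have h2 : (T.map (conjOp U U')).map (conjOp U.symm U'.symm) = T :=
    Matrix.ext fun i j => conjOp_symm_conjOp U U' (T i j)
  rwa [h2] at h1

end Conjugation

/-! ### Matrices over matrix spaces -/

/-- An operator is bounded by `C` if its matrix elements on a dense set of pairs are. -/
lemma opNorm_le_of_norm_inner_le {A B α β : Type*}
    [NormedAddCommGroup A] [InnerProductSpace ℂ A] [NormedAddCommGroup B] [InnerProductSpace ℂ B]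
    {f : α → A} {g : β → B} (hf : DenseRange f) (hg : DenseRange g) (T : A →L[ℂ] B) {C : ℝ}
    (hC : 0 ≤ C) (hT : ∀ a b, ‖⟪g b, T (f a)⟫‖ ≤ C * (‖g b‖ * ‖f a‖)) : ‖T‖ ≤ C := by
  have h1 : ∀ b x, ‖⟪g b, T x⟫‖ ≤ C * (‖g b‖ * ‖x‖) := fun b x =>
    hf.induction_on x (isClosed_le (by fun_prop) (by fun_prop)) fun a => hT a b
  have h2 : ∀ y x, ‖⟪y, T x⟫‖ ≤ C * (‖y‖ * ‖x‖) := fun y x =>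
    hg.induction_on (p := fun y => ‖⟪y, T x⟫‖ ≤ C * (‖y‖ * ‖x‖)) y
      (isClosed_le (by fun_prop) (by fun_prop)) fun b => h1 b x
  refine ContinuousLinearMap.opNorm_le_bound _ hC fun x => ?_
  -- Testing against y = T x gives ‖T x‖² ≤ C ‖T x‖ ‖x‖; a nonzero factor ‖T x‖ is then cancelled.
  have h3 := h2 (T x) x
  rw [inner_self_eq_norm_sq_to_K, norm_pow, RCLike.norm_ofReal, abs_norm] at h3
  rcases (norm_nonneg (T x)).eq_or_lt with h0 | h0
  · rw [← h0]; positivity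
  · exact le_of_mul_le_mul_left (by linarith) h0

section Blocks

variable {H K H' K' h : Type*}
  [NormedAddCommGroup H] [InnerProductSpace ℂ H]
  [NormedAddCommGroup K] [InnerProductSpace ℂ K]
  [NormedAddCommGroup H'] [InnerProductSpace ℂ H']
  [NormedAddCommGroup K'] [InnerProductSpace ℂ K']
  [NormedAddCommGroup h] [InnerProductSpace ℂ h] {n m : ℕ}

/-- The map `H^(nm) → (H ⊗ h)ⁿ` given by `m` vectors of `h`. -/
def rowBlock (f : Fin m → h) (x : PiLp 2 fun _ : Fin (n * m) => H) :
    PiLp 2 fun _ : Fin n => H ⊗ₕ h :=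
  WithLp.toLp 2 fun i => rowL f (WithLp.toLp 2 fun a => x (finProdFinEquiv (i, a)))

/-- Reading an index of `Fin (n * m)` as a pair (i, a), this map is a direct sum of n copies of the
isometry `rowL f`. -/
lemma norm_rowBlock {f : Fin m → h} (hf : Orthonormal ℂ f)
    (x : PiLp 2 fun _ : Fin (n * m) => H) : ‖rowBlock f x‖ = ‖x‖ := by
  rw [← sq_eq_sq₀ (norm_nonneg _) (norm_nonneg _), PiLp.norm_sq_eq_of_L2,
    PiLp.norm_sq_eq_of_L2, ← finProdFinEquiv.sum_comp, Fintype.sum_prod_type]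
  refine Finset.sum_congr rfl fun i _ => ?_
  change ‖rowL f _‖ ^ 2 = _
  rw [norm_rowL hf, PiLp.norm_sq_eq_of_L2]

/-- Finitely many vectors of algebraic tensor products are all in the range of a single
`rowBlock`. -/
lemma exists_rowBlock_eq (c : Fin n → H × h →₀ ℂ) (d : Fin n → K × h →₀ ℂ) :
    ∃ (m : ℕ) (f : Fin m → h), Orthonormal ℂ f ∧
      (∃ u, (WithLp.toLp 2 fun i => Finsupp.linearCombination ℂ
        (fun p : H × h => tm p.1 p.2) (c i)) = rowBlock f u) ∧
      ∃ v, (WithLp.toLp 2 fun i => Finsupp.linearCombination ℂ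
        (fun p : K × h => tm p.1 p.2) (d i)) = rowBlock f v := by
  classical
  -- All second legs occurring in any `c i` or `d i`. One orthonormal basis of their span serves
  -- both tuples, as the two arguments of a matrix element must be expanded in the same family.
  let s : Finset h := Finset.univ.biUnion fun i =>
    (c i).support.image Prod.snd ∪ (d i).support.image Prod.snd
  let S : Submodule ℂ h := Submodule.span ℂ (s : Set h)
  let b : OrthonormalBasis (Fin (Module.finrank ℂ S)) ℂ S := stdOrthonormalBasis ℂ S
  let f : Fin (Module.finrank ℂ S) → h := fun a => (b a : h)
  have hexp : ∀ e ∈ s, ∑ a, ⟪f a, e⟫ • f a = e := by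
    intro e he
    have h2 := congrArg (fun z : S => (z : h)) (b.sum_repr' ⟨e, Submodule.subset_span he⟩)
    simpa using! h2
  have hs : ∀ i, (c i).support.image Prod.snd ∪ (d i).support.image Prod.snd ⊆ s := fun i =>
    Finset.subset_biUnion_of_mem
      (fun i => (c i).support.image Prod.snd ∪ (d i).support.image Prod.snd) (Finset.mem_univ i)
  refine ⟨_, f, b.orthonormal.comp_linearIsometry S.subtypeₗᵢ, ?_, ?_⟩
  · refine ⟨WithLp.toLp 2 fun p => ∑ q ∈ (c (finProdFinEquiv.symm p).1).support,
      (c (finProdFinEquiv.symm p).1 q * ⟪f (finProdFinEquiv.symm p).2, q.2⟫) • q.1, ?_⟩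
    refine congrArg (WithLp.toLp 2) (funext fun i => ?_)
    rw [linearCombination_eq_rowL f (c i) fun q hq => hexp _ (hs i (Finset.mem_union_left _
      (Finset.mem_image_of_mem _ hq)))]
    simp only [Equiv.symm_apply_apply]
  · refine ⟨WithLp.toLp 2 fun p => ∑ q ∈ (d (finProdFinEquiv.symm p).1).support,
      (d (finProdFinEquiv.symm p).1 q * ⟪f (finProdFinEquiv.symm p).2, q.2⟫) • q.1, ?_⟩
    refine congrArg (WithLp.toLp 2) (funext fun i => ?_)
    rw [linearCombination_eq_rowL f (d i) fun q hq => hexp _ (hs i (Finset.mem_union_right _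
      (Finset.mem_image_of_mem _ hq)))]
    simp only [Equiv.symm_apply_apply]

variable (H h n) in
-- Density in each coordinate gives density in the product, and the ℓ² norm on finite tuples induces
-- the product topology.
lemma denseRange_tensor_tuple : DenseRange fun c : Fin n → H × h →₀ ℂ =>
    (WithLp.toLp 2 fun i => Finsupp.linearCombination ℂ (fun p : H × h => tm p.1 p.2) (c i) :
      PiLp 2 fun _ : Fin n => H ⊗ₕ h) := by
  have h1 : DenseRange (Pi.map fun _ : Fin n =>
      (Finsupp.linearCombination ℂ fun p : H × h => tm p.1 p.2 : (H × h →₀ ℂ) → H ⊗ₕ h)) :=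
    DenseRange.piMap fun _ => isTotal_tm_id.denseRange
  exact (PiLp.continuousLinearEquiv 2 ℂ fun _ : Fin n => H ⊗ₕ h).symm.surjective.denseRange.comp
    h1 (PiLp.continuousLinearEquiv 2 ℂ fun _ : Fin n => H ⊗ₕ h).symm.continuous

lemma IsCI.isCC {V : Submodule ℂ (H →L[ℂ] K)} {W : Submodule ℂ (H' →L[ℂ] K')} {φ : V →ₗ[ℂ] W}
    (hφ : IsCI φ) : IsCC φ := fun n A => (hφ n A).le

variable [CompleteSpace K] [CompleteSpace K']

/-- The matrix of all slices, with respect to a finite family of vectors, of the entries of a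
matrix of operators. -/
def blockSlice (f : Fin m → h) (A : Matrix (Fin n) (Fin n) (H ⊗ₕ h →L[ℂ] K ⊗ₕ h)) :
    Matrix (Fin (n * m)) (Fin (n * m)) (H →L[ℂ] K) :=
  Matrix.of fun p q => slice (f (finProdFinEquiv.symm p).2) (f (finProdFinEquiv.symm q).2)
    (A (finProdFinEquiv.symm p).1 (finProdFinEquiv.symm q).1)

/-- In other words, the block-slice matrix is the compression of A by `rowBlock f`, which is an
isometry when f is orthonormal. -/
lemma inner_matOp_blockSlice (f : Fin m → h)
    (A : Matrix (Fin n) (Fin n) (H ⊗ₕ h →L[ℂ] K ⊗ₕ h))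
    (x : PiLp 2 fun _ : Fin (n * m) => H) (y : PiLp 2 fun _ : Fin (n * m) => K) :
    ⟪y, matOp (blockSlice f A) x⟫ = ⟪rowBlock f y, matOp A (rowBlock f x)⟫ := by
  rw [PiLp.inner_apply, PiLp.inner_apply, ← finProdFinEquiv.sum_comp, Fintype.sum_prod_type]
  refine Finset.sum_congr rfl fun i _ => ?_
  rw [matOp_apply, inner_sum]
  simp only [matOp_apply, inner_sum]
  have h1 : ∀ b : Fin m, ∑ q, ⟪y (finProdFinEquiv (i, b)),
      blockSlice f A (finProdFinEquiv (i, b)) q (x q)⟫ = ∑ j, ∑ a,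
        ⟪tm (y (finProdFinEquiv (i, b))) (f b), A i j (tm (x (finProdFinEquiv (j, a))) (f a))⟫ := by
    intro b
    rw [← finProdFinEquiv.sum_comp, Fintype.sum_prod_type]
    simp only [blockSlice, Matrix.of_apply, Equiv.symm_apply_apply, inner_slice]
  rw [Finset.sum_congr rfl fun b _ => h1 b, Finset.sum_comm]
  refine Finset.sum_congr rfl fun j _ => ?_
  simp only [rowBlock, rowL_apply, sum_inner, map_sum, inner_sum]
  exact Finset.sum_comm

lemma norm_matOp_blockSlice_le {f : Fin m → h} (hf : Orthonormal ℂ f)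
    (A : Matrix (Fin n) (Fin n) (H ⊗ₕ h →L[ℂ] K ⊗ₕ h)) :
    ‖matOp (blockSlice f A)‖ ≤ ‖matOp A‖ := by
  refine opNorm_le_of_norm_inner_le (f := id) (g := id) denseRange_id denseRange_id _
    (norm_nonneg (matOp A)) fun x y => ?_
  rw [id, id, inner_matOp_blockSlice, ← norm_rowBlock hf x, ← norm_rowBlock hf y]
  refine (norm_inner_le_norm _ _).trans ?_
  rw [mul_left_comm]
  gcongr
  exact (matOp A).le_opNorm _

/-- The norm of a matrix of operators is determined by its block slices. -/
lemma norm_matOp_le_of_blockSlice (A : Matrix (Fin n) (Fin n) (H ⊗ₕ h →L[ℂ] K ⊗ₕ h)) {C : ℝ}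
    (hC : 0 ≤ C)
    (hA : ∀ (m : ℕ) (f : Fin m → h), Orthonormal ℂ f → ‖matOp (blockSlice f A)‖ ≤ C) :
    ‖matOp A‖ ≤ C := by
  refine opNorm_le_of_norm_inner_le (denseRange_tensor_tuple H h n)
    (denseRange_tensor_tuple K h n) _ hC fun c d => ?_
  -- Each pair of test vectors is captured by a single orthonormal family, so its matrix element is
  -- one of a block-slice matrix.
  obtain ⟨m, f, hf, ⟨u, hu⟩, ⟨v, hv⟩⟩ := exists_rowBlock_eq c d
  rw [hu, hv, ← inner_matOp_blockSlice, norm_rowBlock hf, norm_rowBlock hf]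
  refine (norm_inner_le_norm _ _).trans ?_
  rw [mul_left_comm]
  gcongr
  exact ContinuousLinearMap.le_of_opNorm_le _ (hA m f hf) u

/-- Ampliation does not increase matrix norms. -/
lemma norm_matOp_tmap_id_le (A : Matrix (Fin n) (Fin n) (H →L[ℂ] K)) :
    ‖matOp (A.map fun T => tmap T (ContinuousLinearMap.id ℂ h))‖ ≤ ‖matOp A‖ := by
  refine norm_matOp_le_of_blockSlice _ (norm_nonneg (matOp A)) fun m f hf => ?_
  refine ContinuousLinearMap.opNorm_le_bound _ (norm_nonneg (matOp A)) fun x => ?_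
  -- By orthonormality the block-slice matrix is A ⊗ I_m: it acts as A separately on each of the m
  -- columns indexed by a. Squared norms are then compared column by column.
  have h1 : ∀ i a, matOp (blockSlice f (A.map fun T => tmap T (ContinuousLinearMap.id ℂ h))) x
      (finProdFinEquiv (i, a)) =
        matOp A (WithLp.toLp 2 fun j => x (finProdFinEquiv (j, a))) i := by
    intro i a
    rw [matOp_apply, matOp_apply, ← finProdFinEquiv.sum_comp, Fintype.sum_prod_type]
    refine Finset.sum_congr rfl fun j _ => ?_
    simp only [blockSlice, Matrix.of_apply, Equiv.symm_apply_apply, Matrix.map_apply,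
      slice_tmap_id, smul_apply]
    simp only [orthonormal_iff_ite.1 hf, ite_smul, one_smul, zero_smul, Finset.sum_ite_eq,
      Finset.mem_univ, if_true]
  rw [← sq_le_sq₀ (norm_nonneg _) (by positivity), mul_pow, PiLp.norm_sq_eq_of_L2,
    PiLp.norm_sq_eq_of_L2, ← finProdFinEquiv.sum_comp,
    ← finProdFinEquiv.sum_comp fun p => ‖x p‖ ^ 2, Fintype.sum_prod_type_right,
    Fintype.sum_prod_type_right, Finset.mul_sum]
  refine Finset.sum_le_sum fun a _ => ?_
  simp only [h1]
  have h2 := (matOp A).le_opNorm (WithLp.toLp 2 fun j => x (finProdFinEquiv (j, a)))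
  rw [← sq_le_sq₀ (norm_nonneg _) (by positivity), mul_pow, PiLp.norm_sq_eq_of_L2,
    PiLp.norm_sq_eq_of_L2] at h2
  exact h2

/-! ### Liftings -/

variable {V : Submodule ℂ (H →L[ℂ] K)} {W : Submodule ℂ (H' →L[ℂ] K')} {φ : V →ₗ[ℂ] W}
  {Φ : matrixSpace V h →ₗ[ℂ] matrixSpace W h}

/-- `blockSlice` for matrices over a matrix space. -/
def blockSliceIn (f : Fin m → h) (A : Matrix (Fin n) (Fin n) (matrixSpace V h)) :
    Matrix (Fin (n * m)) (Fin (n * m)) V :=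
  Matrix.of fun p q => sliceIn (f (finProdFinEquiv.symm p).2) (f (finProdFinEquiv.symm q).2)
    (A (finProdFinEquiv.symm p).1 (finProdFinEquiv.symm q).1)

/-- The bridge from Φ at matrix level n to φ at level nm; control of φ at all matrix levels is what
makes it useful. -/
lemma IsLifting.blockSliceIn_map (hΦ : IsLifting φ Φ) (f : Fin m → h)
    (A : Matrix (Fin n) (Fin n) (matrixSpace V h)) :
    blockSliceIn f (A.map Φ) = (blockSliceIn f A).map φ :=
  Matrix.ext fun _ _ => hΦ _ _ _

lemma norm_matOn_blockSliceIn_le {f : Fin m → h} (hf : Orthonormal ℂ f)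
    (A : Matrix (Fin n) (Fin n) (matrixSpace V h)) :
    ‖matOn (blockSliceIn f A)‖ ≤ ‖matOn A‖ :=
  norm_matOp_blockSlice_le hf (A.map fun a => (a : H ⊗ₕ h →L[ℂ] K ⊗ₕ h))

lemma norm_matOn_le_of_blockSliceIn (A : Matrix (Fin n) (Fin n) (matrixSpace V h)) {C : ℝ}
    (hC : 0 ≤ C)
    (hA : ∀ (m : ℕ) (f : Fin m → h), Orthonormal ℂ f → ‖matOn (blockSliceIn f A)‖ ≤ C) :
    ‖matOn A‖ ≤ C :=
  norm_matOp_le_of_blockSlice (A.map fun a => (a : H ⊗ₕ h →L[ℂ] K ⊗ₕ h)) hC hA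

lemma IsLifting.isCC (hΦ : IsLifting φ Φ) (hφ : IsCC φ) : IsCC Φ := fun n A =>
  norm_matOn_le_of_blockSliceIn (A.map Φ) (norm_nonneg (matOn A)) fun m f hf => by
    rw [hΦ.blockSliceIn_map]
    exact (hφ _ _).trans (norm_matOn_blockSliceIn_le hf A)

/-- For the reverse inequality, the norm of A is recovered from its block slices, whose norms φ
preserves and which then become compressions of the image of A. -/
lemma IsLifting.isCI (hΦ : IsLifting φ Φ) (hφ : IsCI φ) : IsCI Φ := fun n A =>
  (hΦ.isCC hφ.isCC n A).antisymm <|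
    norm_matOn_le_of_blockSliceIn A (norm_nonneg (matOn (A.map Φ))) fun m f hf => by
      rw [← hφ, ← hΦ.blockSliceIn_map]
      exact norm_matOn_blockSliceIn_le hf (A.map Φ)

lemma IsLifting.injective (hΦ : IsLifting φ Φ) (hφ : Function.Injective φ) :
    Function.Injective Φ := fun S T hST => Subtype.ext <| ext_slice fun d e =>
  congrArg Subtype.val (show sliceIn d e S = sliceIn d e T from
    hφ (by rw [← hΦ, ← hΦ, hST]))

end Blocks

/-! ### Positivity of liftings. -/

section Positive

open scoped ComplexOrder

variable {H H' h : Type*}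
  [NormedAddCommGroup H] [InnerProductSpace ℂ H] [CompleteSpace H]
  [NormedAddCommGroup H'] [InnerProductSpace ℂ H'] [CompleteSpace H']
  [NormedAddCommGroup h] [InnerProductSpace ℂ h]
  {V : Submodule ℂ (H →L[ℂ] H)} {W : Submodule ℂ (H' →L[ℂ] H')} {φ : V →ₗ[ℂ] W}
  {Φ : matrixSpace V h →ₗ[ℂ] matrixSpace W h}

/-- Nonnegativity of the quadratic form is a closed condition, so it extends from a dense set. In a
complex space it already includes self-adjointness, since the form is real. -/
lemma isPositive_of_inner_nonneg {A α : Type*} [NormedAddCommGroup A] [InnerProductSpace ℂ A]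
    {f : α → A} (hf : DenseRange f) {T : A →L[ℂ] A} (hT : ∀ a, 0 ≤ ⟪f a, T (f a)⟫) :
    T.IsPositive := by
  have h1 : ∀ x, 0 ≤ ⟪x, T x⟫ := fun x =>
    hf.induction_on (p := fun x => 0 ≤ ⟪x, T x⟫) x
      (isClosed_le (by fun_prop) (by fun_prop)) hT
  rw [ContinuousLinearMap.isPositive_iff_complex]
  intro x
  have h2 := h1 x
  rw [← inner_conj_symm] at h2
  obtain ⟨h3, h4⟩ := RCLike.nonneg_iff.1 (star_nonneg_iff.1 h2)
  exact ⟨RCLike.conj_eq_iff_re.1 (RCLike.conj_eq_iff_im.2 h4), h3⟩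

/-- The lifting of a completely positive map preserves positivity. -/
lemma IsLifting.isPositive (hΦ : IsLifting φ Φ) (hφ : IsCP φ) {T : matrixSpace V h}
    (hT : (T : H ⊗ₕ h →L[ℂ] H ⊗ₕ h).IsPositive) :
    (Φ T : H' ⊗ₕ h →L[ℂ] H' ⊗ₕ h).IsPositive := by
  refine isPositive_of_inner_nonneg (isTotal_tm_id (H := H') (K := h)).denseRange fun c => ?_
  -- The one-row case: the test vector becomes `rowL f v`. There the quadratic form of Φ T is that
  -- of φ applied to the slice matrix of T, a compression of T and therefore positive.
  obtain ⟨m, f, hf, ⟨u, hu⟩, -⟩ := exists_rowBlock_eq (n := 1) (fun _ => c) fun _ => c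
  set v : PiLp 2 fun _ : Fin m => H' :=
    WithLp.toLp 2 fun a => u (finProdFinEquiv ((0 : Fin 1), a))
  have hv : Finsupp.linearCombination ℂ (fun p : H' × h => tm p.1 p.2) c = rowL f v :=
    congrArg (fun z : PiLp 2 fun _ : Fin 1 => H' ⊗ₕ h => z 0) hu
  let A : Matrix (Fin m) (Fin m) V := Matrix.of fun b a => sliceIn (f b) (f a) T
  have hA : (matOn A).IsPositive := by
    refine isPositive_of_inner_nonneg (f := id) denseRange_id fun x => ?_
    have h1 := inner_matOp_slice f (T : H ⊗ₕ h →L[ℂ] H ⊗ₕ h) x x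
    exact h1 ▸ hT.inner_nonneg_right (rowL f x)
  have h2 := inner_matOp_slice f (Φ T : H' ⊗ₕ h →L[ℂ] H' ⊗ₕ h) v v
  have h3 : (Matrix.of fun b a => slice (f b) (f a) (Φ T : H' ⊗ₕ h →L[ℂ] H' ⊗ₕ h)) =
      (A.map φ).map fun a => (a : H' →L[ℂ] H') :=
    Matrix.ext fun b a => congrArg Subtype.val (hΦ T (f b) (f a))
  rw [hv, ← h2, h3]
  exact (hφ m A hA).inner_nonneg_right v

end Positive

/-! ### The CCR flow as a faithful unital *-homomorphism. -/

section Flow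

/-- Supplies the nonzero Fock vector on which faithfulness of ampliations rests. -/
lemma expVec_ne_zero {h : Type*} [NormedAddCommGroup h] [InnerProductSpace ℂ h] (f : h) :
    expVec f ≠ 0 := by
  intro h0
  have h1 := inner_expVec f f
  rw [h0, inner_zero_left] at h1
  exact Complex.exp_ne_zero _ h1.symm

variable {H K κ : Type*}
  [NormedAddCommGroup H] [InnerProductSpace ℂ H]
  [NormedAddCommGroup K] [InnerProductSpace ℂ K]
  [NormedAddCommGroup κ] [InnerProductSpace ℂ κ] {R s t : Set ℝ}

lemma ampliate_one (S : Split R s t) : ampliate S (1 : H ⊗ₕ FockOn κ s →L[ℂ] H ⊗ₕ FockOn κ s) = 1 :=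
  (congrArg _ tmap_id).trans (conjOp_id _)

lemma norm_matOp_ampliate_le [CompleteSpace K] {n : ℕ} (S : Split R s t)
    (A : Matrix (Fin n) (Fin n) (H ⊗ₕ FockOn κ s →L[ℂ] K ⊗ₕ FockOn κ s)) :
    ‖matOp (A.map (ampliate S))‖ ≤ ‖matOp A‖ :=
  (norm_matOp_conjOp_le (assemble H S) (assemble K S) _).trans (norm_matOp_tmap_id_le A)

lemma ccrFlow_comp (r : ℝ≥0) (S T : K ⊗ₕ FockOn κ axis →L[ℂ] K ⊗ₕ FockOn κ axis) :
    ccrFlow r (S ∘L T) = ccrFlow r S ∘L ccrFlow r T := by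
  unfold ccrFlow ampliate shiftOp
  rw [← conjOp_comp, tmap_comp, ← conjOp_comp, ContinuousLinearMap.comp_id]

lemma ccrFlow_one (r : ℝ≥0) : ccrFlow r (1 : K ⊗ₕ FockOn κ axis →L[ℂ] K ⊗ₕ FockOn κ axis) = 1 := by
  have h1 : shiftOp r (1 : K ⊗ₕ FockOn κ axis →L[ℂ] K ⊗ₕ FockOn κ axis) = 1 := conjOp_id _
  rw [ccrFlow, h1, ampliate_one]

lemma ccrFlow_injective (r : ℝ≥0) : Function.Injective
    (ccrFlow r : (K ⊗ₕ FockOn κ axis →L[ℂ] K ⊗ₕ FockOn κ axis) → _) := fun _ _ hST =>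
  conjOp_injective _ _ (tmap_id_injective (expVec_ne_zero 0) (conjOp_injective _ _ hST))

lemma norm_ccrFlow_le (r : ℝ≥0) (T : K ⊗ₕ FockOn κ axis →L[ℂ] K ⊗ₕ FockOn κ axis) :
    ‖ccrFlow r T‖ ≤ ‖T‖ :=
  (norm_conjOp _ _ _).trans ((norm_tmap_id_le _).trans (norm_conjOp _ _ _))

lemma adjoint_ccrFlow [CompleteSpace K] (r : ℝ≥0)
    (T : K ⊗ₕ FockOn κ axis →L[ℂ] K ⊗ₕ FockOn κ axis) :
    ContinuousLinearMap.adjoint (ccrFlow r T) = ccrFlow r (ContinuousLinearMap.adjoint T) := by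
  unfold ccrFlow ampliate shiftOp
  rw [adjoint_conjOp, adjoint_tmap_id, adjoint_conjOp]

/-- This concerns kernels of the operators themselves: conjugation by unitaries does not affect
injectivity, and neither does ampliation by a nonzero space. -/
lemma injective_ccrFlow_iff (r : ℝ≥0)
    (T : K ⊗ₕ FockOn κ axis →L[ℂ] K ⊗ₕ FockOn κ axis) :
    Function.Injective (ccrFlow r T) ↔ Function.Injective T := by
  unfold ccrFlow ampliate shiftOp
  rw [injective_conjOp_iff]
  exact ⟨fun h => (injective_conjOp_iff _ _ _).1 (injective_of_tmap_id (expVec_ne_zero 0) h),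
    fun h => injective_tmap_id ((injective_conjOp_iff _ _ _).2 h)⟩

end Flow

/-! ### Operator cocycles -/

section Operator

open ContinuousLinearMap (adjoint)

section Contraction

variable {A : Type*} [NormedAddCommGroup A] [InnerProductSpace ℂ A] [CompleteSpace A]

/-- If a product of two contractions is isometric, then so is the right factor. -/
lemma adjoint_comp_self_of_comp {S T : A →L[ℂ] A} (hS : ‖S‖ ≤ 1) (hT : ‖T‖ ≤ 1)
    (h : adjoint (S ∘L T) ∘L (S ∘L T) = 1) : adjoint T ∘L T = 1 := by
  have h1 : ∀ x, ‖S (T x)‖ = ‖x‖ :=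
    (ContinuousLinearMap.norm_map_iff_adjoint_comp_self (S ∘L T)).2 h
  refine (ContinuousLinearMap.norm_map_iff_adjoint_comp_self T).1 fun x => le_antisymm ?_ ?_
  · simpa using T.le_of_opNorm_le hT x
  · rw [← h1 x]
    simpa using S.le_of_opNorm_le hS (T x)

lemma adjoint_comp_self_comp {S T : A →L[ℂ] A} (hS : adjoint S ∘L S = 1)
    (hT : adjoint T ∘L T = 1) : adjoint (S ∘L T) ∘L (S ∘L T) = 1 := by
  rw [← ContinuousLinearMap.norm_map_iff_adjoint_comp_self] at hS hT ⊢
  intro x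
  rw [ContinuousLinearMap.comp_apply, hS, hT]

end Contraction

variable {K κ : Type*}
  [NormedAddCommGroup K] [InnerProductSpace ℂ K]
  [NormedAddCommGroup κ] [InnerProductSpace ℂ κ]
  {X : ℝ≥0 → K ⊗ₕ FockOn κ axis →L[ℂ] K ⊗ₕ FockOn κ axis}

/-- Injectivity of a product passes to the factor acting first: σ_r(X_t), hence X_t, for the left
law and X_r for the right law. -/
lemma dichotomy_injective (hX : (∀ r t, X (r + t) = X r ∘L ccrFlow r (X t)) ∨
    ∀ r t, X (r + t) = ccrFlow r (X t) ∘L X r) :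
    Dichotomy {t | 0 < t ∧ Function.Injective (X t)} := by
  rcases hX with hX | hX
  · refine dichotomy_of_add_right (fun r t hr ht => ?_) fun r t h => ?_
    · rw [hX]
      exact hr.comp ((injective_ccrFlow_iff r _).2 ht)
    · rw [hX] at h
      exact (injective_ccrFlow_iff r _).1 (Function.Injective.of_comp h)
  · refine dichotomy_of_add_left (fun r t hr ht => ?_) fun r t h => ?_
    · rw [hX]
      exact ((injective_ccrFlow_iff r _).2 ht).comp hr
    · rw [hX, ContinuousLinearMap.coe_comp] at h
      exact Function.Injective.of_comp h

variable [CompleteSpace K]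

lemma adjoint_comp_self_ccrFlow_iff (r : ℝ≥0)
    (T : K ⊗ₕ FockOn κ axis →L[ℂ] K ⊗ₕ FockOn κ axis) :
    adjoint (ccrFlow r T) ∘L ccrFlow r T = 1 ↔ adjoint T ∘L T = 1 := by
  rw [adjoint_ccrFlow, ← ccrFlow_comp]
  -- With the identity written as σ_r(1), the equivalence is faithfulness of the flow.
  nth_rewrite 1 [← ccrFlow_one r]
  exact (ccrFlow_injective r).eq_iff

lemma dichotomy_isometric (hX : (∀ r t, X (r + t) = X r ∘L ccrFlow r (X t)) ∨
    ∀ r t, X (r + t) = ccrFlow r (X t) ∘L X r) (hc : ∀ t, ‖X t‖ ≤ 1) :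
    Dichotomy {t | 0 < t ∧ adjoint (X t) ∘L X t = 1} := by
  have hf : ∀ r t, ‖ccrFlow r (X t)‖ ≤ 1 := fun r t => (norm_ccrFlow_le r _).trans (hc t)
  rcases hX with hX | hX
  · refine dichotomy_of_add_right (fun r t hr ht => ?_) fun r t h => ?_
    · rw [hX]
      exact adjoint_comp_self_comp hr ((adjoint_comp_self_ccrFlow_iff r _).2 ht)
    · rw [hX] at h
      exact (adjoint_comp_self_ccrFlow_iff r _).1 (adjoint_comp_self_of_comp (hc r) (hf r t) h)
  · refine dichotomy_of_add_left (fun r t hr ht => ?_) fun r t h => ?_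
    · rw [hX]
      exact adjoint_comp_self_comp ((adjoint_comp_self_ccrFlow_iff r _).2 ht) hr
    · rw [hX] at h
      exact adjoint_comp_self_of_comp (hf r t) (hc r) h

/-- The adjoint process obeys the opposite composition law, because σ_r commutes with adjoints. -/
lemma dichotomy_coisometric (hX : (∀ r t, X (r + t) = X r ∘L ccrFlow r (X t)) ∨
    ∀ r t, X (r + t) = ccrFlow r (X t) ∘L X r) (hc : ∀ t, ‖X t‖ ≤ 1) :
    Dichotomy {t | 0 < t ∧ X t ∘L adjoint (X t) = 1} := by
  have h1 := dichotomy_isometric (X := fun t => adjoint (X t)) (hX.symm.imp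
    (fun h r t => by rw [h, ContinuousLinearMap.adjoint_comp, adjoint_ccrFlow])
    fun h r t => by rw [h, ContinuousLinearMap.adjoint_comp, adjoint_ccrFlow])
    fun t => by rw [LinearIsometryEquiv.norm_map]; exact hc t
  simpa only [ContinuousLinearMap.adjoint_adjoint] using h1

end Operator

/-! ### Mapping cocycles -/

section Mapping

variable {H K κ : Type*}
  [NormedAddCommGroup H] [InnerProductSpace ℂ H]
  [NormedAddCommGroup K] [InnerProductSpace ℂ K] [CompleteSpace K]
  [NormedAddCommGroup κ] [InnerProductSpace ℂ κ]
  {V : Submodule ℂ (H →L[ℂ] K)} {k : ℝ≥0 → V →ₗ[ℂ] matrixSpace V (FockOn κ axis)}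

lemma IsCocycle.isLifting (hk : IsCocycle V k) (r : ℝ≥0) :
    IsLifting (pastMap V r ∘ₗ k r) (lifting (FockOn κ (after r)) (pastMap V r ∘ₗ k r)) :=
  isLifting_lifting _ ((hk.cb r).past r)

/-- The values of an adapted process are ampliations of their past parts. -/
lemma IsCocycle.ampliate_pastMap (hk : IsCocycle V k) (r : ℝ≥0) (a : V) :
    ampliate (cut r) (pastMap V r (k r a) :
      H ⊗ₕ FockOn κ (before r) →L[ℂ] K ⊗ₕ FockOn κ (before r)) = k r a := by
  obtain ⟨S, -, hS⟩ := hk.adapted r a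
  change ampliate (cut r) (pastOp r (k r a : H ⊗ₕ FockOn κ axis →L[ℂ] K ⊗ₕ FockOn κ axis)) = _
  rw [hS, pastOp_ampliate]

/-- By adaptedness k_r(a) is the ampliation of its past part, so equal past parts give equal values.
-/
lemma IsCocycle.injective_past (hk : IsCocycle V k) {r : ℝ≥0}
    (hr : Function.Injective (k r)) : Function.Injective (pastMap V r ∘ₗ k r) := fun a b hab =>
  hr (Subtype.ext (by
    rw [← hk.ampliate_pastMap r a, ← hk.ampliate_pastMap r b]
    exact congrArg (fun T : matrixSpace V (FockOn κ (before r)) => ampliate (cut r)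
      (T : H ⊗ₕ FockOn κ (before r) →L[ℂ] K ⊗ₕ FockOn κ (before r))) hab))

lemma IsCC.past {r : ℝ≥0} (hr : IsCC (k r)) : IsCC (pastMap V r ∘ₗ k r) := fun n A =>
  (norm_matOp_pastOp_le r _).trans (hr n A)

/-- Vacuum compression and ampliation are both completely contractive, and by adaptedness the second
undoes the first on the range of k_r. -/
lemma IsCocycle.isCI_past (hk : IsCocycle V k) {r : ℝ≥0} (hr : IsCI (k r)) :
    IsCI (pastMap V r ∘ₗ k r) := fun n A => (hr.isCC.past n A).antisymm <| by
  rw [← hr]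
  have h1 : (A.map (k r)).map (fun a => (a : H ⊗ₕ FockOn κ axis →L[ℂ] K ⊗ₕ FockOn κ axis)) =
      ((A.map (pastMap V r ∘ₗ k r)).map fun a =>
        (a : H ⊗ₕ FockOn κ (before r) →L[ℂ] K ⊗ₕ FockOn κ (before r))).map (ampliate (cut r)) :=
    Matrix.ext fun i j => (hk.ampliate_pastMap r (A i j)).symm
  rw [matOn, h1]
  exact norm_matOp_ampliate_le (cut r) _

lemma norm_matOn_shiftMap {n : ℕ} (r : ℝ≥0)
    (A : Matrix (Fin n) (Fin n) (matrixSpace V (FockOn κ axis))) :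
    ‖matOn (A.map (shiftMap V r))‖ = ‖matOn A‖ :=
  norm_matOp_conjOp _ _ (A.map fun a => (a : H ⊗ₕ FockOn κ axis →L[ℂ] K ⊗ₕ FockOn κ axis))

lemma shiftMap_injective (r : ℝ≥0) : Function.Injective (shiftMap (κ := κ) V r) :=
  fun _ _ hST => Subtype.ext (conjOp_injective _ _ (congrArg Subtype.val hST))

/-- The cocycle relation for matrix norms. -/
lemma IsCocycle.norm_matOn_add (hk : IsCocycle V k) (r t : ℝ≥0) {n : ℕ}
    (A : Matrix (Fin n) (Fin n) V) :
    ‖matOn (A.map (k (r + t)))‖ = ‖matOn (((A.map (k t)).map (shiftMap V r)).map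
      (lifting (FockOn κ (after r)) (pastMap V r ∘ₗ k r)))‖ := by
  rw [matOn, matOn, ← norm_matOp_conjOp (assemble H (cut r)) (assemble K (cut r))]
  congr 2
  exact Matrix.ext fun i j => hk.add r t (A i j)

lemma IsCocycle.dichotomy_injective (hk : IsCocycle V k) :
    Dichotomy {t | 0 < t ∧ Function.Injective (k t)} := by
  refine dichotomy_of_add_right (fun r t hr ht a b hab => ?_) fun r t h a b hab => ?_
  · have h1 := congrArg Subtype.val hab
    rw [hk.add, hk.add] at h1
    exact ht (shiftMap_injective r ((hk.isLifting r).injective (hk.injective_past hr)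
      (Subtype.ext (conjOp_injective _ _ h1))))
  · exact h (Subtype.ext (by rw [hk.add, hk.add, hab]))

/-- Sums: the lifting, the shift and k_t each preserve matrix norms. Inheritance: a loss of norm
under k_t cannot be regained by the complete contractions applied after it. -/
lemma IsCocycle.dichotomy_isCI (hk : IsCocycle V k) (hc : ∀ t, IsCC (k t)) :
    Dichotomy {t | 0 < t ∧ IsCI (k t)} := by
  refine dichotomy_of_add_right (fun r t hr ht n A => ?_) fun r t h n A => ?_
  · rw [hk.norm_matOn_add, (hk.isLifting r).isCI (hk.isCI_past hr), norm_matOn_shiftMap, ht]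
  · refine (hc t n A).antisymm ?_
    rw [← h, hk.norm_matOn_add, ← norm_matOn_shiftMap r (A.map (k t))]
    exact (hk.isLifting r).isCC (hc r).past n _

end Mapping

/-! ### Unitality of completely positive contractive cocycles. -/

section Unital

open scoped ComplexOrder

variable {H κ : Type*}
  [NormedAddCommGroup H] [InnerProductSpace ℂ H]
  [NormedAddCommGroup κ] [InnerProductSpace ℂ κ]

/-- The past parts are compressions by the isometry x ↦ x ⊗ Ω, with Ω the vacuum, applied in each
coordinate. -/
lemma isPositive_matOp_pastOp {n : ℕ} (r : ℝ≥0)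
    {A : Matrix (Fin n) (Fin n) (H ⊗ₕ FockOn κ axis →L[ℂ] H ⊗ₕ FockOn κ axis)}
    (hA : (matOp A).IsPositive) : (matOp (A.map (pastOp r))).IsPositive := by
  refine isPositive_of_inner_nonneg (f := id) denseRange_id fun x => ?_
  have h1 : ⟪x, matOp (A.map (pastOp r)) x⟫ =
      ⟪(WithLp.toLp 2 fun i => assemble H (cut r) (tm (x i) (expVec 0)) :
        PiLp 2 fun _ : Fin n => H ⊗ₕ FockOn κ axis),
        matOp A (WithLp.toLp 2 fun i => assemble H (cut r) (tm (x i) (expVec 0)))⟫ := by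
    rw [PiLp.inner_apply, PiLp.inner_apply]
    refine Finset.sum_congr rfl fun i _ => ?_
    rw [matOp_apply, matOp_apply, inner_sum, inner_sum]
    refine Finset.sum_congr rfl fun l _ => ?_
    rw [Matrix.map_apply, pastOp, LinearMap.comp_apply, inner_slice, conjOp_apply',
      LinearIsometryEquiv.symm_symm, ← LinearIsometryEquiv.inner_map_map (assemble H (cut r)),
      LinearIsometryEquiv.apply_symm_apply]
  rw [id, h1]
  exact hA.inner_nonneg_right _

variable [CompleteSpace H]
  {W : Submodule ℂ (H →L[ℂ] H)} {j : ℝ≥0 → W →ₗ[ℂ] matrixSpace W (FockOn κ axis)}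

lemma IsCP.past {r : ℝ≥0} (hr : IsCP (j r)) : IsCP (pastMap W r ∘ₗ j r) := fun n A hA =>
  isPositive_matOp_pastOp r (hr n A hA)

/-- The identity operator as an element of a matrix space. -/
def matrixOne {h : Type*} [NormedAddCommGroup h] [InnerProductSpace ℂ h] (h1 : 1 ∈ W) :
    matrixSpace W h :=
  ⟨1, fun d e => by
    have h2 : (1 : H ⊗ₕ h →L[ℂ] H ⊗ₕ h) = tmap 1 (ContinuousLinearMap.id ℂ h) := tmap_id.symm
    rw [h2, slice_tmap_id]
    exact W.smul_mem _ h1⟩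

lemma sliceIn_matrixOne {h : Type*} [NormedAddCommGroup h] [InnerProductSpace ℂ h] (h1 : 1 ∈ W)
    (d e : h) : sliceIn d e (matrixOne h1) = ⟪d, e⟫ • (⟨1, h1⟩ : W) :=
  Subtype.ext (by
    have h2 : (1 : H ⊗ₕ h →L[ℂ] H ⊗ₕ h) = tmap 1 (ContinuousLinearMap.id ℂ h) := tmap_id.symm
    change slice d e (1 : H ⊗ₕ h →L[ℂ] H ⊗ₕ h) = _
    rw [h2, slice_tmap_id]
    rfl)

/-- The slices of the identity are ⟪d, e⟫ 1, so the lifting sends it to the ampliation of the past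
part of j_r(1), which adaptedness identifies with j_r(1). -/
lemma IsCocycle.hat_matrixOne (hj : IsCocycle W j) (h1 : 1 ∈ W) (r : ℝ≥0) :
    hat j r (matrixOne h1) = j r ⟨1, h1⟩ := by
  have h2 : (lifting (FockOn κ (after r)) (pastMap W r ∘ₗ j r) (matrixOne h1) :
      (H ⊗ₕ FockOn κ (before r)) ⊗ₕ FockOn κ (after r) →L[ℂ]
        (H ⊗ₕ FockOn κ (before r)) ⊗ₕ FockOn κ (after r)) =
      tmap (pastMap W r (j r ⟨1, h1⟩) :
        H ⊗ₕ FockOn κ (before r) →L[ℂ] H ⊗ₕ FockOn κ (before r))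
        (ContinuousLinearMap.id ℂ (FockOn κ (after r))) := by
    refine ext_slice fun d e => ?_
    have h3 := hj.isLifting r (matrixOne h1) d e
    rw [sliceIn_matrixOne, map_smul] at h3
    rw [slice_tmap_id]
    exact congrArg Subtype.val h3
  rw [hat, h2]
  exact hj.ampliate_pastMap r ⟨1, h1⟩

lemma shiftMap_eq_matrixOne (h1 : 1 ∈ W) (r : ℝ≥0) {T : matrixSpace W (FockOn κ axis)}
    (hT : (T : H ⊗ₕ FockOn κ axis →L[ℂ] H ⊗ₕ FockOn κ axis) = 1) :
    shiftMap W r T = matrixOne h1 :=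
  Subtype.ext ((congrArg (shiftOp r) hT).trans (conjOp_id _))

/-- A positive contraction is dominated by the identity. -/
lemma isPositive_one_sub {A : Type*} [NormedAddCommGroup A] [InnerProductSpace ℂ A]
    [CompleteSpace A] {T : A →L[ℂ] A} (hT : T.IsPositive) (hc : ‖T‖ ≤ 1) :
    (1 - T).IsPositive := by
  have h1 := CStarAlgebra.norm_le_one_iff_of_nonneg T
    ((ContinuousLinearMap.nonneg_iff_isPositive T).2 hT)
  exact (ContinuousLinearMap.le_def _ _).1 (h1.1 hc)

lemma isPositive_of_isCP {H' : Type*} [NormedAddCommGroup H'] [InnerProductSpace ℂ H']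
    [CompleteSpace H'] {U : Submodule ℂ (H' →L[ℂ] H')} {φ : W →ₗ[ℂ] U} (hφ : IsCP φ) {a : W}
    (ha : (a : H →L[ℂ] H).IsPositive) : (φ a : H' →L[ℂ] H').IsPositive := by
  have h1 : (matOn (Matrix.of fun _ _ : Fin 1 => a)).IsPositive := by
    refine isPositive_of_inner_nonneg (f := id) denseRange_id fun x => ?_
    simpa [PiLp.inner_apply, matOp_apply] using ha.inner_nonneg_right (x 0)
  refine isPositive_of_inner_nonneg (f := id) denseRange_id fun x => ?_
  simpa [PiLp.inner_apply, matOp_apply] using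
    (hφ 1 _ h1).inner_nonneg_right (WithLp.toLp 2 fun _ => x)

lemma IsCocycle.dichotomy_unital (hj : IsCocycle W j) (h1 : 1 ∈ W)
    (hc : ∀ t, IsCP (j t) ∧ ∀ a : W, ‖j t a‖ ≤ ‖a‖) :
    Dichotomy {t | 0 < t ∧ (j t ⟨1, h1⟩ : H ⊗ₕ FockOn κ axis →L[ℂ] H ⊗ₕ FockOn κ axis) = 1} := by
  have hp : ∀ t, (1 - (j t ⟨1, h1⟩ : H ⊗ₕ FockOn κ axis →L[ℂ] H ⊗ₕ FockOn κ axis)).IsPositive :=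
    fun t => isPositive_one_sub
      (isPositive_of_isCP (hc t).1 (ContinuousLinearMap.isPositive_one))
      -- Only ‖1‖ ≤ 1 is available, since the Hilbert space may be trivial.
      (((hc t).2 _).trans ContinuousLinearMap.norm_id_le)
  refine dichotomy_of_add_left (fun r t hr ht => ?_) fun r t h => ?_
  · rw [hj.add, shiftMap_eq_matrixOne h1 r ht, hj.hat_matrixOne, hr]
  · have h2 : (hat j r (matrixOne h1 - shiftMap W r (j t ⟨1, h1⟩))).IsPositive := by
      refine isPositive_conjOp _ ((hj.isLifting r).isPositive (hc r).1.past ?_)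
      have h3 : ((matrixOne h1 - shiftMap W r (j t ⟨1, h1⟩) : matrixSpace W (FockOn κ (after r))) :
          H ⊗ₕ FockOn κ (after r) →L[ℂ] H ⊗ₕ FockOn κ (after r)) =
          shiftOp r (1 - (j t ⟨1, h1⟩ : H ⊗ₕ FockOn κ axis →L[ℂ] H ⊗ₕ FockOn κ axis)) := by
        rw [map_sub]
        exact congrArg (· - _) (conjOp_id _).symm
      rw [h3]
      exact isPositive_conjOp _ (hp t)
    have h4 : hat j r (matrixOne h1 - shiftMap W r (j t ⟨1, h1⟩)) =
        (j r ⟨1, h1⟩ : H ⊗ₕ FockOn κ axis →L[ℂ] H ⊗ₕ FockOn κ axis) - 1 := by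
      rw [← hj.hat_matrixOne h1, ← h, hj.add]
      simp only [hat, map_sub, Submodule.coe_sub]
    rw [h4] at h2
    exact le_antisymm ((ContinuousLinearMap.le_def _ _).2 (hp r))
      ((ContinuousLinearMap.le_def _ _).2 h2)

end Unital

end QS

end

theorem proposition4p8
    {κ H K L M : Type*}
    [NormedAddCommGroup κ] [InnerProductSpace ℂ κ] [CompleteSpace κ]
    [NormedAddCommGroup H] [InnerProductSpace ℂ H] [CompleteSpace H]
    [NormedAddCommGroup K] [InnerProductSpace ℂ K] [CompleteSpace K]
    [NormedAddCommGroup L] [InnerProductSpace ℂ L] [CompleteSpace L]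
    [NormedAddCommGroup M] [InnerProductSpace ℂ M] [CompleteSpace M]
    (V : Submodule ℂ (H →L[ℂ] K)) (hV : QS.IsOperatorSpace V)
    (k : ℝ≥0 → V →ₗ[ℂ] QS.matrixSpace V (QS.FockOn κ QS.axis)) (hk : QS.IsCocycle V k)
    (W : Submodule ℂ (L →L[ℂ] L)) (hW : QS.IsOperatorSystem W)
    (j : ℝ≥0 → W →ₗ[ℂ] QS.matrixSpace W (QS.FockOn κ QS.axis)) (hj : QS.IsCocycle W j)
    (X : ℝ≥0 → M ⊗ₕ QS.FockOn κ QS.axis →L[ℂ] M ⊗ₕ QS.FockOn κ QS.axis)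
    (hX : QS.IsLeftCocycle X ∨ QS.IsRightCocycle X) :
    QS.Dichotomy {t | 0 < t ∧ Function.Injective (k t)} ∧
    QS.Dichotomy {t | 0 < t ∧ Function.Injective (X t)} ∧
    ((∀ t, QS.IsCC (k t)) → QS.Dichotomy {t | 0 < t ∧ QS.IsCI (k t)}) ∧
    ((∀ t, QS.IsCP (j t) ∧ ∀ a : W, ‖j t a‖ ≤ ‖a‖) →
      QS.Dichotomy {t | 0 < t ∧
        (j t ⟨1, hW.one_mem⟩ : L ⊗ₕ QS.FockOn κ QS.axis →L[ℂ]
          L ⊗ₕ QS.FockOn κ QS.axis) = 1}) ∧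
    ((∀ t, ‖X t‖ ≤ 1) →
      QS.Dichotomy {t | 0 < t ∧ ContinuousLinearMap.adjoint (X t) ∘L X t = 1} ∧
      QS.Dichotomy {t | 0 < t ∧ X t ∘L ContinuousLinearMap.adjoint (X t) = 1}) := by
  have hX' : (∀ r t, X (r + t) = X r ∘L QS.ccrFlow r (X t)) ∨
      ∀ r t, X (r + t) = QS.ccrFlow r (X t) ∘L X r := hX.imp (fun h => h.add) fun h => h.add
  exact ⟨hk.dichotomy_injective, QS.dichotomy_injective hX', hk.dichotomy_isCI,
    hj.dichotomy_unital hW.one_mem,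
    fun hc => ⟨QS.dichotomy_isometric hX' hc, QS.dichotomy_coisometric hX' hc⟩⟩
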